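/- **Setting.** Let $X\sim P_X$ be a source symbol (standard Borel alphabet), $X'\sim P_{X'|X}(\cdot|X)$ side information available only to the decoder, $P_{Y'|X}$ a target channel and $Q_{Y'}$ a proposal distribution; $P_{Y'|X}(\cdot|x)$ and $Q_{Y'}$ are given by (jointly) measurable densities with respect to a common $\sigma$-finite measure. Let $P_{X,X',Y'}$ be the joint law under which $X'-X-Y'$ is a Markov chain, and $P_{Y'}$, $P_{Y'|X'}$ the induced marginal and posterior. Assume the extended bounding condition with $\omega\ge 1$: $P_{Y'|X}(y|x)\le\omega\,Q_{Y'}(y)$ for all $x,y$. For each $x$ the encoder uses a ratio bound $\omega_x\in[1,\omega]$, measurable in $x$, with $P_{Y'|X}(y|x)\le\omega_x Q_{Y'}(y)$ for all $y$ (e.g. $\omega_x=\sup_y P_{Y'|X}(y|x)/Q_{Y'}(y)$ when this is measurable, or $\omega_x=\omega$). The shared randomness $W$, independent of $(X,X')$, consists of i.i.d. batches $i=1,2,\dots$; batch $i$ contains a $U_i\sim\mathrm{Unif}(0,1)$ and $N$ triples $(Y'_{ij},V_{ij},S_{ij})$, $1\le j\le N$, all independent, with $Y'_{ij}\sim Q_{Y'}$,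 $V_{ij}$ uniform on $\{1,\dots,\mathcal V\}$ (a hash value, $\mathcal V\ge1$) and $S_{ij}\sim\mathrm{Exp}(1)$. *Encoder.* Given $X=x$, put $\lambda_{ij}=P_{Y'|X}(Y'_{ij}|x)/Q_{Y'}(Y'_{ij})$, $k_i=\arg\min_j S_{ij}/\lambda_{ij}$ and $\hat Z_i=\sum_j\lambda_{ij}$. Batch $i$ is accepted if $U_i\le \hat Z_i/(\hat Z_i+\omega_x-\lambda_{i,k_i})$. Let $K_{1,A}$ be the first accepted batch and $K_A=(K_{1,A},k_{K_{1,A}})$. The encoder sends $K_{1,A}$ and the hash value $V_{K_A}$. *Decoder.* Given $X'=x'$ and the message, it lets $K_B$ be the position in batch $i=K_{1,A}$ that minimizes $S_{ij}\,Q_{Y'}(Y'_{ij})/P_{Y'|X'}(Y'_{ij}|x')$ among the $j$ with $V_{ij}=V_{K_A}$. For $\varepsilon>0$ let $N_0(\varepsilon)$ be any number such that for every $N\ge N_0(\varepsilon)$ and $P_X$-almost every $x$, both $\mu_1'(N)=\frac{3\omega_x}{N}$ and $\mu_2'(N)=\frac{\omega_x}{N}\,\mathbb I_N\,\mathbb E_{Y\sim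 Q_{Y'}}\!\big[Q_{Y'}(Y)/P_{Y'|X}(Y|x)\big]$ are at most $\varepsilon$, where $\mathbb I_N=2$ for $N>2$, $\mathbb I_2=\omega$ and $\mathbb I_1=0$ (assume that such a number exists). **Proposition.** Let $\varepsilon>0$ and $N\ge\max(N_0(\varepsilon),\omega)$. Then $$\Pr\big(Y'_{K_A}\ne Y'_{K_B}\big)\le \mathbb E_{X,X',Y'}\Big[1-\big(1+\varepsilon+(1+\varepsilon)\mathcal V^{-1}2^{\,i(Y';X)-i(Y';X')}\big)^{-1}\Big],$$ where $i(y';x)=\log_2P_{Y'|X}(y'|x)-\log_2P_{Y'}(y')$, $i(y';x')=\log_2P_{Y'|X'}(y'|x')-\log_2P_{Y'}(y')$, and $(X,X',Y')\sim P_{X,X',Y'}$. The coding cost is $\log_2\mathcal V+r$ bits with $r\le4$ the cost of the batch index. Precisely: there are a binary prefix-free code for $K_{1,A}$ of expected length $r\le 4$ and a binary prefix-free code for the hash value all of whose code words have length $\lceil\log_2\mathcal V\rceil$ (which is $\log_2\mathcal V$ if $\mathcal V$ is a power of two), and the concatenated message has expected length $\lceil\log_2\mathcal V\rceil+r\le\log_2\mathcal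 V+4$; so the bound of $4$ bits above $\log_2\mathcal V$ also covers the rounding of $\log_2\mathcal V$. -/

import Mathlib

open MeasureTheory ProbabilityTheory
open scoped ENNReal

namespace ERS

noncomputable section

/-! ### Densities, bounding conditions and information density

All densities are taken with respect to a common reference measure on the output alphabet `𝒴`.
`p x y` stands for `P_{Y'|X}(y|x)` and `q y` for `Q_{Y'}(y)`. -/

/-- The pair of densities `(f, q)` satisfies the bounding condition with constant `c`:
`f y / q y ≤ c` for all `y` (in particular `f` vanishes where `q` does). -/
def BoundingCondition {𝒴 : Type*} (f q : 𝒴 → ℝ) (c : ℝ) : Prop :=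
  1 ≤ c ∧ ∀ y, f y ≤ c * q y

/-- The extended bounding condition: `p x y / q y ≤ c` for all `x` and `y`. -/
def ExtendedBoundingCondition {𝒳 𝒴 : Type*} (p : 𝒳 → 𝒴 → ℝ) (q : 𝒴 → ℝ) (c : ℝ) : Prop :=
  1 ≤ c ∧ ∀ x y, p x y ≤ c * q y

/-- The density of `∫ P_{Y'|X}(· | x) ρ(dx)`. With `ρ = P_X` this is the density of `P_{Y'}`; with
`ρ = P_{X|X'}(· | x')` it is the density of `P_{Y'|X'}(· | x')`, as `X' - X - Y'` is a Markov
chain. -/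
def mixDensity {𝒳 𝒴 : Type*} [MeasurableSpace 𝒳] (p : 𝒳 → 𝒴 → ℝ) (ρ : Measure 𝒳) (y : 𝒴) : ℝ :=
  ∫ x, p x y ∂ρ

/-- The density `P_{Y'|X'}(y | x')` used by the decoder: `η` is the side information channel
`P_{X'|X}` and `posterior η PX` is the conditional law `P_{X|X'}`. -/
def decoderDensity {𝒳 𝒳' 𝒴 : Type*} [MeasurableSpace 𝒳] [StandardBorelSpace 𝒳] [Nonempty 𝒳]
    [MeasurableSpace 𝒳'] (PX : Measure 𝒳) [IsProbabilityMeasure PX] (η : Kernel 𝒳 𝒳')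
    [IsMarkovKernel η] (p : 𝒳 → 𝒴 → ℝ) (x' : 𝒳') (y : 𝒴) : ℝ :=
  mixDensity p (posterior η PX x') y

/-- Information density in bits, from the values of the conditional and of the marginal density. -/
def infoDensity (cond marg : ℝ) : ℝ := Real.logb 2 cond - Real.logb 2 marg

/-- The joint law `P_{X,X',Y'}`: given `X`, the variables `X' ∼ η` and `Y' ∼ κ = P_{Y'|X}` are
independent. -/
def tripleLaw {𝒳 𝒳' 𝒴 : Type*} [MeasurableSpace 𝒳] [MeasurableSpace 𝒳'] [MeasurableSpace 𝒴]
    (PX : Measure 𝒳) (η : Kernel 𝒳 𝒳') (κ : Kernel 𝒳 𝒴) : Measure (𝒳 × 𝒳' × 𝒴) :=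
  PX ⊗ₘ (η ×ₖ κ)

/-! ### The shared randomness -/

/-- A batch: `N` proposals `(Y'_j, V_j, S_j)`, together with one uniform variable `U`. -/
abbrev Batch (𝒴 : Type*) (N V : ℕ) : Type _ := (Fin N → 𝒴 × Fin V × ℝ) × ℝ

/-- The shared randomness `W`: an infinite sequence of batches. -/
abbrev Randomness (𝒴 : Type*) (N V : ℕ) : Type _ := ℕ → Batch 𝒴 N V

/-- The law of a batch: `Y'_j ∼ Q`, `V_j` uniform on `V` hash values, `S_j ∼ Exp(1)` and
`U ∼ Unif(0,1)`, all independent. -/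
def batchLaw {𝒴 : Type*} [MeasurableSpace 𝒴] (Q : Measure 𝒴) (N V : ℕ) : Measure (Batch 𝒴 N V) :=
  (Measure.pi fun _ : Fin N =>
    Q.prod ((uniformOn (Set.univ : Set (Fin V))).prod (expMeasure 1))).prod
      (volume.restrict (Set.Icc (0 : ℝ) 1))

instance {𝒴 : Type*} [MeasurableSpace 𝒴] (Q : Measure 𝒴) [IsProbabilityMeasure Q] (N V : ℕ)
    [NeZero V] : IsProbabilityMeasure (batchLaw Q N V) := by
  have h1 : IsProbabilityMeasure (uniformOn (Set.univ : Set (Fin V))) :=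
    isProbabilityMeasure_uniformOn Set.finite_univ Set.univ_nonempty
  have h2 : IsProbabilityMeasure (expMeasure 1) := isProbabilityMeasure_expMeasure one_pos
  have h3 : IsProbabilityMeasure (volume.restrict (Set.Icc (0 : ℝ) 1)) := ⟨by simp⟩
  unfold batchLaw
  infer_instance

/-- The law of `W`: the batches are i.i.d. -/
def randomnessLaw {𝒴 : Type*} [MeasurableSpace 𝒴] (Q : Measure 𝒴) [IsProbabilityMeasure Q]
    (N V : ℕ) [NeZero V] : Measure (Randomness 𝒴 N V) :=
  Measure.infinitePi fun _ : ℕ => batchLaw Q N V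

/-- The joint law of `((X, X'), W)`: the source and the side information are independent of the
shared randomness. -/
def systemLaw {𝒳 𝒳' 𝒴 : Type*} [MeasurableSpace 𝒳] [MeasurableSpace 𝒳'] [MeasurableSpace 𝒴]
    (PX : Measure 𝒳) (η : Kernel 𝒳 𝒳') (Q : Measure 𝒴) [IsProbabilityMeasure Q] (N V : ℕ)
    [NeZero V] : Measure ((𝒳 × 𝒳') × Randomness 𝒴 N V) :=
  (PX ⊗ₘ η).prod (randomnessLaw Q N V)

/-! ### Selection rules -/

/-- The competition value `s / l` of a proposal with exponential variable `s` and weight `l`; it is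
`∞` if the weight vanishes (and `s > 0`). -/
def score (s l : ℝ) : ℝ≥0∞ := ENNReal.ofReal s / ENNReal.ofReal l

open scoped Classical in
/-- `argmin_{k ∈ s} f k`, ties being broken in favour of the smallest index (and with an irrelevant
default value if `s` is empty). -/
def argminOn {N : ℕ} [NeZero N] (s : Finset (Fin N)) (f : Fin N → ℝ≥0∞) : Fin N :=
  if h : (s.filter fun k => ∀ j ∈ s, f k ≤ f j).Nonempty then
    (s.filter fun k => ∀ j ∈ s, f k ≤ f j).min' h
  else 0

section Selection

variable {𝒴 : Type*} {N V : ℕ}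

/-- The weight `λ_k = f(Y'_k) / q(Y'_k)` of the `k`-th proposal of a batch, for target `f`. -/
def weight (f q : 𝒴 → ℝ) (B : Batch 𝒴 N V) (k : Fin N) : ℝ := f (B.1 k).1 / q (B.1 k).1

/-- Gumbel-max selection, within a batch, among the proposals in `s`:
`argmin_{k ∈ s} S_k / λ_k`. -/
def gumbel [NeZero N] (f q : 𝒴 → ℝ) (s : Finset (Fin N)) (B : Batch 𝒴 N V) : Fin N :=
  argminOn s fun k => score (B.1 k).2.2 (weight f q B k)

/-- The sum `Ẑ` of all weights of a batch. -/
def zHat (f q : 𝒴 → ℝ) (B : Batch 𝒴 N V) : ℝ := ∑ k, weight f q B k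

/-- `Z̄ = Ẑ + c - λ_k`, where `c` is the ratio bound used by the sampler. -/
def zBar (f q : 𝒴 → ℝ) (c : ℝ) (B : Batch 𝒴 N V) (k : Fin N) : ℝ :=
  zHat f q B + c - weight f q B k

/-- Ensemble rejection sampling accepts the candidate of a batch iff `U ≤ Ẑ / Z̄`. -/
def Accepts [NeZero N] (f q : 𝒴 → ℝ) (c : ℝ) (B : Batch 𝒴 N V) : Prop :=
  B.2 ≤ zHat f q B / zBar f q c B (gumbel f q Finset.univ B)

/-- The index (counted from `0`) of the first accepted batch. (That no batch is accepted has
probability zero for the targets considered; the value is then `0`.) -/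
def batchIndex [NeZero N] (f q : 𝒴 → ℝ) (c : ℝ) (W : Randomness 𝒴 N V) : ℕ :=
  sInf {i | Accepts f q c (W i)}

/-- The output of ensemble rejection sampling: batch index and local index. -/
def ersSelect [NeZero N] (f q : 𝒴 → ℝ) (c : ℝ) (W : Randomness 𝒴 N V) : ℕ × Fin N :=
  (batchIndex f q c W, gumbel f q Finset.univ (W (batchIndex f q c W)))

/-- The sample `Y'` at a position of `W`. -/
def sampleAt (W : Randomness 𝒴 N V) (K : ℕ × Fin N) : 𝒴 := ((W K.1).1 K.2).1

/-- The hash value `V` at a position of `W`. -/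
def hashAt (W : Randomness 𝒴 N V) (K : ℕ × Fin N) : Fin V := ((W K.1).1 K.2).2.1

/-- The encoder's message: batch index and hash value of the selected position. -/
def message [NeZero N] (f q : 𝒴 → ℝ) (c : ℝ) (W : Randomness 𝒴 N V) : ℕ × Fin V :=
  ((ersSelect f q c W).1, hashAt W (ersSelect f q c W))

/-- The decoder, with target density `g`, upon message `m`: it keeps the batch `m.1`, removes all
proposals whose hash value differs from `m.2`, and applies Gumbel-max selection. -/
def decode [NeZero N] (g q : 𝒴 → ℝ) (W : Randomness 𝒴 N V) (m : ℕ × Fin V) : ℕ × Fin N :=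
  (m.1, gumbel g q (Finset.univ.filter fun j => hashAt W (m.1, j) = m.2) (W m.1))

end Selection

/-! ### Decoding error -/

section Error

variable {𝒳 𝒳' 𝒴 : Type*} [MeasurableSpace 𝒳] [StandardBorelSpace 𝒳] [Nonempty 𝒳]
  [MeasurableSpace 𝒳']

/-- The event `Y'_{K_A} ≠ Y'_{K_B}`. The encoder runs ensemble rejection sampling with target
`p x` and ratio bound `w x`; the decoder's target is `P_{Y'|X'}(· | x')`. -/
def errorEvent (PX : Measure 𝒳) [IsProbabilityMeasure PX] (η : Kernel 𝒳 𝒳') [IsMarkovKernel η]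
    (p : 𝒳 → 𝒴 → ℝ) (q : 𝒴 → ℝ) (w : 𝒳 → ℝ) (N V : ℕ) [NeZero N] :
    Set ((𝒳 × 𝒳') × Randomness 𝒴 N V) :=
  {t | sampleAt t.2 (ersSelect (p t.1.1) q (w t.1.1) t.2) ≠
    sampleAt t.2
      (decode (decoderDensity PX η p t.1.2) q t.2 (message (p t.1.1) q (w t.1.1) t.2))}

/-- The integrand
`1 - (1 + ε + (1 + ε) V⁻¹ 2^{i(y;x) - i(y;x')})⁻¹` of the error bound. -/
def errorBound (PX : Measure 𝒳) [IsProbabilityMeasure PX] (η : Kernel 𝒳 𝒳') [IsMarkovKernel η]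
    (p : 𝒳 → 𝒴 → ℝ) (ε : ℝ) (V : ℕ) (t : 𝒳 × 𝒳' × 𝒴) : ℝ :=
  1 - (1 + ε + (1 + ε) * (V : ℝ)⁻¹ *
    (2 : ℝ) ^ (infoDensity (p t.1 t.2.2) (mixDensity p PX t.2.2) -
      infoDensity (decoderDensity PX η p t.2.1 t.2.2) (mixDensity p PX t.2.2)))⁻¹

end Error

/-! ### The decay coefficients and the threshold on the batch size -/

/-- `d₂(Q‖P) = E_{Y ∼ Q}[Q(Y) / P(Y)]`, with value in `[0, ∞]`; `f` is the density of `P`. -/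
def d2 {𝒴 : Type*} [MeasurableSpace 𝒴] (Q : Measure 𝒴) (q f : 𝒴 → ℝ) : ℝ≥0∞ :=
  ∫⁻ y, ENNReal.ofReal (q y) / ENNReal.ofReal (f y) ∂Q

/-- `𝕀_N(ω, i) = 2 · 1{N > i} + ω · 1{N = i}`. -/
def indicatorCoeff (N : ℕ) (ω : ℝ) (i : ℕ) : ℝ :=
  (if i < N then 2 else 0) + (if N = i then ω else 0)

/-- `μ'₁(N) = 3c / N`, where `c` is the ratio bound used by the encoder. -/
def mu1 (c : ℝ) (N : ℕ) : ℝ≥0∞ := ENNReal.ofReal (3 * c / N)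

/-- `μ'₂(N) = (c / N) 𝕀_N(ω, 2) d₂`, where `c` is the ratio bound used by the encoder and `ω` a
bound for the ratios of both parties. -/
def mu2 (c ω : ℝ) (N : ℕ) (d : ℝ≥0∞) : ℝ≥0∞ := ENNReal.ofReal (c / N * indicatorCoeff N ω 2) * d

/-- `N₀` is an admissible value of `N₀(ε)`: for every batch size `N ≥ N₀`, both coefficients are at
most `ε`, for almost every source symbol. -/
def IsThreshold {𝒳 𝒴 : Type*} [MeasurableSpace 𝒳] [MeasurableSpace 𝒴] (PX : Measure 𝒳)
    (Q : Measure 𝒴) (p : 𝒳 → 𝒴 → ℝ) (q : 𝒴 → ℝ) (w : 𝒳 → ℝ) (ω ε : ℝ) (N₀ : ℕ) : Prop :=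
  ∀ N : ℕ, N₀ ≤ N → ∀ᵐ x ∂PX,
    mu1 (w x) N ≤ ENNReal.ofReal ε ∧ mu2 (w x) ω N (d2 Q q (p x)) ≤ ENNReal.ofReal ε

/-! ### Binary codes -/

/-- A binary prefix-free code: no code word is a prefix of the code word of another symbol. -/
def IsPrefixFree {α : Type*} (c : α → List Bool) : Prop := ∀ a b, c a <+: c b → a = b

/-- The coding cost `E[ℓ(M)]` of a random binary string `M`, in bits. -/
def codingCost {Ω : Type*} [MeasurableSpace Ω] (μ : Measure Ω) (M : Ω → List Bool) : ℝ≥0∞ :=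
  ∫⁻ t, ((M t).length : ℝ≥0∞) ∂μ

end

end ERS

namespace ERS

noncomputable section

/-! It suffices to bound the probability of agreement from below, counting only the event that the
very first batch is accepted and one position strictly wins both the encoder's and the decoder's
race. Fix the candidate's value y. Let l and g be the two weights (density ratios to q) at y, T the
sum of the other encoder weights, G the sum of the decoder weights of the other proposals carrying
the candidate's hash, and c the encoder's ratio bound. An exponential variable wins its race with
probability 1/(1+S), where S sums the speed ratios (`race_expMeasure`). Winning both races amounts
to taking the larger ratio for each competitor, so S ≤ T/l + G/g. Times the acceptance probability
(T+l)/(T+c), this is at least l/Z with Z = T + c + (l/g)G + (l/g)c·G/(T+l)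
(`div_add_le_of_ratio_le`).

Jensen's inequality replaces Z by its mean. Here T has mean at most N-1, G has mean at most (N-1)/V
because hashes agree with probability 1/V, and G/(T+l) has mean at most 𝕀_N d₂/V
(`lintegral_sum_div_le`). The conditions on μ'₁ and μ'₂ then give E Z ≤ N(1+ε+(1+ε)V⁻¹ l/g). The N
positions yield disjoint events, which cancels the factor N (`le_measure_iUnion_raceEvent`,
`le_batchLaw_matchEvent`). Integrating against l dQ = dP_{Y'|X} gives the error bound, since l/g =
2^{i(y;x)-i(y;x')} almost surely.

For the encoder alone, the probability of winning and being accepted is exactly l/(T+c), and E(T+c)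
= N-1+c ≤ 2N as c ≤ ω ≤ N. Hence every batch is accepted with probability at least 1/2
(`le_batchLaw_acceptEvent`), and a unary code for the batch index costs at most 2 bits on average
(`lintegral_batchIndex_add_one_le`). Rounding log₂ V costs at most one more bit. -/

/-- Jensen's inequality for the inverse. -/
lemma inv_lintegral_le_lintegral_inv {α : Type*} [MeasurableSpace α] (μ : Measure α)
    [IsProbabilityMeasure μ] {Z : α → ℝ≥0∞} (hZ : Measurable Z) (h0 : ∀ a, Z a ≠ 0)
    (hT : ∀ a, Z a ≠ ⊤) : (∫⁻ a, Z a ∂μ)⁻¹ ≤ ∫⁻ a, (Z a)⁻¹ ∂μ := by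
  have hpow (x : ℝ≥0∞) : (x ^ (1 / 2 : ℝ)) ^ (2 : ℝ) = x := by
    rw [← ENNReal.rpow_mul]; norm_num
  -- Cauchy–Schwarz for Z^{1/2} and Z^{-1/2}, whose product is 1.
  have h := ENNReal.lintegral_mul_le_Lp_mul_Lq μ Real.HolderConjugate.two_two
    (f := fun a => Z a ^ (1 / 2 : ℝ)) (g := fun a => (Z a)⁻¹ ^ (1 / 2 : ℝ))
    (hZ.pow_const _).aemeasurable (hZ.inv.pow_const _).aemeasurable
  simp only [Pi.mul_apply, hpow] at h
  rw [← ENNReal.mul_rpow_of_nonneg _ _ (by norm_num)] at h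
  have h1 : ∀ a, Z a ^ (1 / 2 : ℝ) * (Z a)⁻¹ ^ (1 / 2 : ℝ) = 1 := fun a => by
    rw [← ENNReal.mul_rpow_of_nonneg _ _ (by norm_num), ENNReal.mul_inv_cancel (h0 a) (hT a),
      ENNReal.one_rpow]
  simp only [h1, lintegral_const, measure_univ, mul_one] at h
  have h2 : 1 ≤ (∫⁻ a, Z a ∂μ) * ∫⁻ a, (Z a)⁻¹ ∂μ := by
    by_contra hc
    push Not at hc
    exact absurd h (not_le.mpr (ENNReal.rpow_lt_one hc (by norm_num)))
  rw [ENNReal.inv_le_iff_le_mul]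
  · exact h2
  · intro _ h3
    simp [h3] at h2
  · intro _ h3
    rw [lintegral_eq_zero_iff (by fun_prop)] at h3
    obtain ⟨a, ha⟩ := h3.exists
    exact hT a (by simpa using ha)

/-! ### Exponential variables and their races -/

lemma expMeasure_Ioi {t : ℝ} (ht : 0 ≤ t) :
    expMeasure 1 (Set.Ioi t) = ENNReal.ofReal (Real.exp (-t)) := by
  have := isProbabilityMeasure_expMeasure one_pos
  rw [← Set.compl_Iic, prob_compl_eq_one_sub measurableSet_Iic, ← ofReal_cdf,
    cdf_expMeasure_eq one_pos, if_pos ht, ← ENNReal.ofReal_one,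
    ← ENNReal.ofReal_sub _ (by simp [ht])]
  simp

/-- Tilting the Exp(1) density by exp(-sm) gives 1/(1+m) times the Exp(1+m) density, which has mass
1. -/
lemma lintegral_exp_neg_mul_expMeasure {m : ℝ} (hm : 0 ≤ m) :
    ∫⁻ s, ENNReal.ofReal (Real.exp (-(s * m))) ∂(expMeasure 1) = ENNReal.ofReal (1 / (1 + m)) := by
  have hm' : 0 < 1 + m := by linarith
  have hpdf (r : ℝ) : Measurable (exponentialPDF r) :=
    (measurable_exponentialPDFReal r).ennreal_ofReal
  change ∫⁻ s, _ ∂(volume.withDensity (exponentialPDF 1)) = _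
  rw [lintegral_withDensity_eq_lintegral_mul _ (hpdf 1) (by fun_prop)]
  have h : ∀ s, (exponentialPDF 1 * fun s => ENNReal.ofReal (Real.exp (-(s * m)))) s
      = ENNReal.ofReal (1 / (1 + m)) * exponentialPDF (1 + m) s := fun s => by
    rw [Pi.mul_apply, exponentialPDF_eq, exponentialPDF_eq]
    split_ifs with hs
    · rw [← ENNReal.ofReal_mul (by positivity), ← ENNReal.ofReal_mul (by positivity), one_mul,
        ← Real.exp_add, ← mul_assoc, one_div_mul_cancel hm'.ne', one_mul]
      ring_nf
    · simp
  simp_rw [h]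
  rw [lintegral_const_mul _ (hpdf _), lintegral_exponentialPDF_eq_one hm', mul_one]

lemma ae_pos_expMeasure : ∀ᵐ s ∂(expMeasure 1), 0 < s := by
  have := isProbabilityMeasure_expMeasure one_pos
  have h : expMeasure 1 (Set.Ioi 0) = 1 := by simp [expMeasure_Ioi le_rfl]
  exact (prob_compl_eq_zero_iff measurableSet_Ioi).mpr h

lemma lintegral_pi_insertNth {α : Type*} [MeasurableSpace α] (μ : Measure α) [SigmaFinite μ]
    {n : ℕ} (j : Fin (n + 1)) {F : (Fin (n + 1) → α) → ℝ≥0∞} (hF : Measurable F) :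
    ∫⁻ z, F z ∂(Measure.pi fun _ => μ)
      = ∫⁻ a, ∫⁻ r, F (j.insertNth a r) ∂(Measure.pi fun _ => μ) ∂μ := by
  have h := (measurePreserving_piFinSuccAbove (fun _ : Fin (n + 1) => μ) j).symm
  rw [← h.lintegral_comp hF, lintegral_prod]
  · rfl
  · exact (hF.comp h.measurable).aemeasurable

/-- The probability that the exponential variable `j` wins a race with speed ratios `m`. -/
lemma race_expMeasure {n : ℕ} (j : Fin (n + 1)) (m : Fin n → ℝ) (hm : ∀ i, 0 ≤ m i) :
    (Measure.pi fun _ : Fin (n + 1) => expMeasure 1)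
      {s | 0 < s j ∧ ∀ i, s j * m i < s (j.succAbove i)} = ENNReal.ofReal (1 / (1 + ∑ i, m i)) := by
  have := isProbabilityMeasure_expMeasure one_pos
  have hmeas : MeasurableSet {s : Fin (n + 1) → ℝ | 0 < s j ∧ ∀ i, s j * m i < s (j.succAbove i)} := by
    measurability
  rw [← lintegral_indicator_one hmeas, lintegral_pi_insertNth _ j (measurable_one.indicator hmeas),
    ← lintegral_exp_neg_mul_expMeasure (Finset.sum_nonneg fun i _ => hm i)]
  -- Given s for variable j, the others independently exceed s·m i with probability exp(-s·m i); the
  -- product is the Laplace integrand at the sum of the m i.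
  refine lintegral_congr_ae (ae_pos_expMeasure.mono fun s hs => ?_)
  have h1 : (fun r : Fin n → ℝ => ({s : Fin (n + 1) → ℝ | 0 < s j ∧
      ∀ i, s j * m i < s (j.succAbove i)}.indicator 1 (j.insertNth s r) : ℝ≥0∞))
      = (Set.univ.pi fun i => Set.Ioi (s * m i)).indicator 1 := by
    funext r
    simp [Set.indicator, hs, Set.mem_pi]
  simp only [h1]
  rw [lintegral_indicator_one (MeasurableSet.univ_pi fun _ => measurableSet_Ioi), Measure.pi_pi,
    Finset.prod_congr rfl fun i _ => expMeasure_Ioi (mul_nonneg hs.le (hm i)),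
    ← ENNReal.ofReal_prod_of_nonneg fun _ _ => (Real.exp_pos _).le, ← Real.exp_sum,
    Finset.sum_neg_distrib, Finset.mul_sum]

/-! ### Races between marked proposals, followed by an acceptance test -/

section Race

variable {α : Type*} {n : ℕ}

/-- Position `j` wins the race with speed ratios `m`. -/
def raceWin (m : α → α → ℝ) (j : Fin (n + 1)) :
    Set ((Fin (n + 1) → α) × (Fin (n + 1) → ℝ)) :=
  {t | 0 < t.2 j ∧ ∀ i, t.2 j * m (t.1 (j.succAbove i)) (t.1 j) < t.2 (j.succAbove i)}

/-- Position `j` holds a value in `D`, wins the race with speed ratios `m` and is accepted with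
probability `acc`. -/
def raceEvent (m : α → α → ℝ) (D : Set α) (acc : (Fin (n + 1) → α) → ℝ) (j : Fin (n + 1)) :
    Set (((Fin (n + 1) → α) × (Fin (n + 1) → ℝ)) × ℝ) :=
  {t | t.1.1 j ∈ D ∧ t.1 ∈ raceWin m j ∧ t.2 ≤ acc t.1.1}

variable [MeasurableSpace α]

lemma measurableSet_raceWin {m : α → α → ℝ} (hm : Measurable (Function.uncurry m))
    (j : Fin (n + 1)) : MeasurableSet (raceWin m j) := by
  have h1 (i : Fin n) : Measurable fun t : (Fin (n + 1) → α) × (Fin (n + 1) → ℝ) =>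
      m (t.1 (j.succAbove i)) (t.1 j) :=
    hm.comp (f := fun t : (Fin (n + 1) → α) × (Fin (n + 1) → ℝ) =>
      (t.1 (j.succAbove i), t.1 j)) (by fun_prop)
  rw [raceWin, Set.ofPred_and, Set.ofPred_forall]
  exact (measurableSet_lt (by fun_prop) (by fun_prop)).inter
    (MeasurableSet.iInter fun i => measurableSet_lt (by fun_prop) (by fun_prop))

lemma measurableSet_raceEvent {m : α → α → ℝ} (hm : Measurable (Function.uncurry m)) {D : Set α}
    (hD : MeasurableSet D) {acc : (Fin (n + 1) → α) → ℝ} (hacc : Measurable acc)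
    (j : Fin (n + 1)) : MeasurableSet (raceEvent m D acc j) := by
  rw [raceEvent, Set.ofPred_and, Set.ofPred_and]
  exact (measurableSet_preimage (f := fun t : ((Fin (n + 1) → α) × (Fin (n + 1) → ℝ)) × ℝ =>
    t.1.1 j) (by fun_prop) hD).inter
    ((measurable_fst (measurableSet_raceWin hm j)).inter
      (measurableSet_le (by fun_prop) (by fun_prop)))

lemma volume_Icc_zero_one_setOf_le {r : ℝ} (h1 : r ≤ 1) :
    volume.restrict (Set.Icc (0 : ℝ) 1) {u | u ≤ r} = ENNReal.ofReal r := by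
  rw [Measure.restrict_apply (measurableSet_le (by fun_prop) (by fun_prop))]
  have : {u : ℝ | u ≤ r} ∩ Set.Icc 0 1 = Set.Icc 0 r := by
    ext u; simp only [Set.mem_inter_iff, Set.mem_ofPred_eq, Set.mem_Icc]
    exact ⟨fun h => ⟨h.2.1, h.1⟩, fun h => ⟨h.2, h.1, h.2.trans h1⟩⟩
  simp [this]

/-- The variables are integrated out in turn: the uniform one yields `acc`, the exponential ones the
winning probability given all marks, and Tonelli then singles out the mark of the candidate `j`. -/
lemma measure_raceEvent (μ : Measure α) [IsProbabilityMeasure μ] {m : α → α → ℝ}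
    (hm : Measurable (Function.uncurry m)) (hm0 : ∀ a b, 0 ≤ m a b) {D : Set α}
    (hD : MeasurableSet D) {acc : (Fin (n + 1) → α) → ℝ} (hacc : Measurable acc)
    (hacc1 : ∀ z, acc z ≤ 1) (j : Fin (n + 1)) :
    (((Measure.pi fun _ => μ).prod (Measure.pi fun _ => expMeasure 1)).prod
      (volume.restrict (Set.Icc (0 : ℝ) 1))) (raceEvent m D acc j)
      = ∫⁻ a, D.indicator (fun a => ∫⁻ r, ENNReal.ofReal (acc (j.insertNth a r)) *
          ENNReal.ofReal (1 / (1 + ∑ i, m (r i) a)) ∂(Measure.pi fun _ : Fin n => μ)) a ∂μ := by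
  have := isProbabilityMeasure_expMeasure one_pos
  have hE := measurableSet_raceEvent hm hD hacc j
  have hm1 (i : Fin n) : Measurable fun z : Fin (n + 1) → α => m (z (j.succAbove i)) (z j) :=
    hm.comp (f := fun z : Fin (n + 1) → α => (z (j.succAbove i), z j)) (by fun_prop)
  have hR := measurableSet_raceWin hm j
  rw [Measure.prod_apply hE]
  have h1 : ∀ t : (Fin (n + 1) → α) × (Fin (n + 1) → ℝ),
      volume.restrict (Set.Icc (0 : ℝ) 1) (Prod.mk t ⁻¹' raceEvent m D acc j)
        = D.indicator (fun _ => ENNReal.ofReal (acc t.1)) (t.1 j) *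
          (raceWin m j).indicator 1 t := by
    intro t
    by_cases hd : t.1 j ∈ D
    · by_cases hs : t ∈ raceWin m j
      · have : Prod.mk t ⁻¹' raceEvent m D acc j = {u | u ≤ acc t.1} := by
          ext u
          simp only [raceEvent, Set.mem_preimage, Set.mem_ofPred_eq]
          exact ⟨fun h => h.2.2, fun h => ⟨hd, hs, h⟩⟩
        rw [this, volume_Icc_zero_one_setOf_le (hacc1 _)]
        simp [hd, hs]
      · have : Prod.mk t ⁻¹' raceEvent m D acc j = ∅ :=
          Set.eq_empty_of_forall_notMem fun u h => hs h.2.1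
        simp [this, hs]
    · have : Prod.mk t ⁻¹' raceEvent m D acc j = ∅ :=
        Set.eq_empty_of_forall_notMem fun u h => hd h.1
      simp [this, hd]
  have hind : Measurable fun z : Fin (n + 1) → α =>
      D.indicator (fun _ => ENNReal.ofReal (acc z)) (z j) := by
    have : (fun z : Fin (n + 1) → α => D.indicator (fun _ => ENNReal.ofReal (acc z)) (z j))
      = ((fun z : Fin (n + 1) → α => z j) ⁻¹' D).indicator fun z => ENNReal.ofReal (acc z) := by
      funext z; rfl
    rw [this]
    exact hacc.ennreal_ofReal.indicator (measurable_pi_apply j hD)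
  simp_rw [h1]
  rw [lintegral_prod _ (Measurable.aemeasurable (by
    exact (hind.comp measurable_fst).mul (measurable_one.indicator hR)))]
  have h2 : ∀ z : Fin (n + 1) → α,
      ∫⁻ s, D.indicator (fun _ => ENNReal.ofReal (acc z)) (z j) *
          ((raceWin m j).indicator 1 (z, s) : ℝ≥0∞) ∂(Measure.pi fun _ => expMeasure 1)
        = D.indicator (fun _ => ENNReal.ofReal (acc z)) (z j) *
          ENNReal.ofReal (1 / (1 + ∑ i, m (z (j.succAbove i)) (z j))) := by
    intro z
    rw [lintegral_const_mul _ (by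
        exact (measurable_one.indicator hR).comp measurable_prodMk_left),
      ← race_expMeasure j (fun i => m (z (j.succAbove i)) (z j)) fun i => hm0 _ _]
    congr 1
    exact lintegral_indicator_one (measurable_prodMk_left hR)
  simp_rw [h2]
  rw [lintegral_pi_insertNth _ j (by fun_prop)]
  refine lintegral_congr fun a => ?_
  by_cases ha : a ∈ D <;> simp [ha]

end Race

/-! ### Separating the marks of a batch from its exponential variables -/

section Batch

variable {𝒴 : Type*} [MeasurableSpace 𝒴] {N V : ℕ}

/-- The components of a batch: samples and hash values, exponential variables, acceptance
variable. -/
def batchSplit (B : Batch 𝒴 N V) : ((Fin N → 𝒴 × Fin V) × (Fin N → ℝ)) × ℝ :=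
  ((fun i => ((B.1 i).1, (B.1 i).2.1), fun i => (B.1 i).2.2), B.2)

lemma measurePreserving_batchSplit (Q : Measure 𝒴) [IsProbabilityMeasure Q] [NeZero V] :
    MeasurePreserving (batchSplit (𝒴 := 𝒴) (N := N) (V := V)) (batchLaw Q N V)
      (((Measure.pi fun _ => Q.prod (uniformOn Set.univ)).prod
        (Measure.pi fun _ => expMeasure 1)).prod (volume.restrict (Set.Icc (0 : ℝ) 1))) := by
  have h1 : IsProbabilityMeasure (uniformOn (Set.univ : Set (Fin V))) :=
    isProbabilityMeasure_uniformOn Set.finite_univ Set.univ_nonempty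
  have h2 : IsProbabilityMeasure (expMeasure 1) := isProbabilityMeasure_expMeasure one_pos
  have h3 := (measurePreserving_prodAssoc Q (uniformOn (Set.univ : Set (Fin V))) (expMeasure 1)).symm
  have h4 := measurePreserving_pi (fun _ : Fin N => _) (fun _ => _) fun _ => h3
  have h5 := (measurePreserving_arrowProdEquivProdArrow (𝒴 × Fin V) ℝ (Fin N)
    (fun _ => Q.prod (uniformOn Set.univ)) fun _ => expMeasure 1).comp h4
  exact h5.prod (MeasurePreserving.id _)

end Batch

/-! ### The mean of G/(T+l) -/

section Estimates

variable {α : Type*} [MeasurableSpace α]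

/-- The inequality between harmonic and arithmetic means; if some `x i` vanishes, the right-hand
side is infinite. It reduces the inverse of a sum of weights to the inverse weights measured by d₂.
-/
lemma inv_sum_ofReal_le {k : ℕ} (hk : 0 < k) (x : Fin k → ℝ) (hx : ∀ i, 0 ≤ x i) :
    (∑ i, ENNReal.ofReal (x i))⁻¹ ≤ ((k : ℝ≥0∞) ^ 2)⁻¹ * ∑ i, (ENNReal.ofReal (x i))⁻¹ := by
  by_cases h : ∀ i, 0 < x i
  · have hs : 0 < ∑ i, x i := Finset.sum_pos (fun i _ => h i) ⟨⟨0, hk⟩, Finset.mem_univ _⟩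
    have hk' : (0 : ℝ) < (k : ℝ) ^ 2 := by positivity
    have hsed := Finset.sq_sum_div_le_sum_sq_div Finset.univ (fun _ : Fin k => (1 : ℝ))
      (g := x) fun i _ => h i
    simp only [Finset.sum_const, Finset.card_univ, Fintype.card_fin, nsmul_eq_mul, mul_one,
      one_pow, one_div] at hsed
    rw [← ENNReal.ofReal_sum_of_nonneg fun i _ => hx i, ← ENNReal.ofReal_inv_of_pos hs,
      Finset.sum_congr rfl fun i _ => (ENNReal.ofReal_inv_of_pos (h i)).symm,
      ← ENNReal.ofReal_sum_of_nonneg fun i _ => (inv_pos.mpr (h i)).le,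
      ← ENNReal.ofReal_natCast, ← ENNReal.ofReal_pow (Nat.cast_nonneg k),
      ← ENNReal.ofReal_inv_of_pos hk', ← ENNReal.ofReal_mul (by positivity)]
    refine ENNReal.ofReal_le_ofReal ?_
    rw [inv_mul_eq_div, le_div_iff₀ hk', mul_comm, ← div_eq_mul_inv]
    exact hsed
  · push Not at h
    obtain ⟨i, hi⟩ := h
    have : ∑ i, (ENNReal.ofReal (x i))⁻¹ = ⊤ :=
      ENNReal.sum_eq_top.mpr ⟨i, Finset.mem_univ _, by simp [ENNReal.ofReal_of_nonpos hi]⟩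
    rw [this, ENNReal.mul_top]
    · exact le_top
    · simp [ENNReal.pow_eq_top_iff]

lemma lintegral_pi_sum (μ : Measure α) [IsProbabilityMeasure μ] {n : ℕ} {f : α → ℝ≥0∞}
    (hf : Measurable f) :
    ∫⁻ r : Fin n → α, ∑ i, f (r i) ∂(Measure.pi fun _ => μ) = n * ∫⁻ a, f a ∂μ := by
  rw [lintegral_finsetSum _ fun i _ => by fun_prop]
  have : ∀ i : Fin n, ∫⁻ r : Fin n → α, f (r i) ∂(Measure.pi fun _ => μ) = ∫⁻ a, f a ∂μ :=
    fun i => (measurePreserving_eval (fun _ : Fin n => μ) i).lintegral_comp hf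
  simp [this]

/-- The coefficient `𝕀_N` controls the contribution of the competing proposals. -/
lemma lintegral_sum_div_le (μ : Measure α) [IsProbabilityMeasure μ] {l h : α → ℝ}
    (hl : Measurable l) (hh : Measurable h) (hl0 : ∀ a, 0 ≤ l a) (hh0 : ∀ a, 0 ≤ h a)
    {b d : ℝ≥0∞} {ω : ℝ} (hb : ∫⁻ a, ENNReal.ofReal (h a) ∂μ ≤ b)
    (hd : ∫⁻ a, (ENNReal.ofReal (l a))⁻¹ ∂μ ≤ d)
    (hhl : ∫⁻ a, ENNReal.ofReal (h a) * (ENNReal.ofReal (l a))⁻¹ ∂μ ≤ b * (ENNReal.ofReal ω * d))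
    {n : ℕ} {t : ℝ} (ht : 0 < t) :
    ∫⁻ r : Fin n → α, ENNReal.ofReal ((∑ i, h (r i)) / (∑ i, l (r i) + t))
      ∂(Measure.pi fun _ => μ) ≤ b * (ENNReal.ofReal (indicatorCoeff (n + 1) ω 2) * d) := by
  have hinv {x y : ℝ} (hx : 0 ≤ x) (hxy : x < y) (z : ℝ) (hz : 0 ≤ z) :
      ENNReal.ofReal (z / y) ≤ ENNReal.ofReal z * (ENNReal.ofReal x)⁻¹ := by
    rw [ENNReal.ofReal_div_of_pos (hx.trans_lt hxy), div_eq_mul_inv]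
    gcongr
  match n with
  | 0 => simp
  -- Here `n` counts the competitors. A single one occurs in both numerator and denominator, so
  -- independence is of no use; `hhl` bounds the quotient instead, at the price of `ω`.
  | 1 =>
    have h1 : ENNReal.ofReal (indicatorCoeff (1 + 1) ω 2) = ENNReal.ofReal ω := by
      simp [indicatorCoeff]
    rw [h1, lintegral_pi_insertNth μ 0 (by fun_prop)]
    refine le_trans ?_ hhl
    refine lintegral_mono fun a => ?_
    simpa using hinv (hl0 a) (lt_add_of_pos_right _ ht) (h a) (hh0 a)
  | k + 2 =>
    have h1 : ENNReal.ofReal (indicatorCoeff (k + 2 + 1) ω 2) = 2 := by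
      simp [indicatorCoeff]
    have hpt : ∀ r : Fin (k + 2) → α, ENNReal.ofReal ((∑ i, h (r i)) / (∑ i, l (r i) + t))
        = ∑ i, ENNReal.ofReal (h (r i) / (∑ i, l (r i) + t)) := fun r => by
      rw [Finset.sum_div, ENNReal.ofReal_sum_of_nonneg fun i _ => div_nonneg (hh0 _)
        (add_nonneg (Finset.sum_nonneg fun i _ => hl0 _) ht.le)]
    simp_rw [hpt]
    rw [lintegral_finsetSum _ fun i _ => by fun_prop, h1]
    -- Dropping competitor `j` from the denominator makes it independent of the numerator `h (r j)`
    -- and leaves `k + 1` weights for the harmonic mean bound.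
    have hterm : ∀ j : Fin (k + 2), ∫⁻ r : Fin (k + 2) → α,
        ENNReal.ofReal (h (r j) / (∑ i, l (r i) + t)) ∂(Measure.pi fun _ => μ)
          ≤ b * (((k + 1 : ℕ) : ℝ≥0∞)⁻¹ * d) := fun j => by
      rw [lintegral_pi_insertNth μ j (by fun_prop)]
      calc _ ≤ ∫⁻ a, ∫⁻ r : Fin (k + 1) → α, ENNReal.ofReal (h a) *
            ((((k + 1 : ℕ) : ℝ≥0∞) ^ 2)⁻¹ * ∑ i, (ENNReal.ofReal (l (r i)))⁻¹)
              ∂(Measure.pi fun _ => μ) ∂μ := by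
            refine lintegral_mono fun a => lintegral_mono fun r => ?_
            rw [Fin.sum_univ_succAbove _ j]
            simp only [Fin.insertNth_apply_same, Fin.insertNth_apply_succAbove]
            refine (hinv (x := ∑ i, l (r i)) (Finset.sum_nonneg fun i _ => hl0 _)
              (by linarith [hl0 a]) _ (hh0 a)).trans ?_
            gcongr
            rw [ENNReal.ofReal_sum_of_nonneg fun i _ => hl0 _]
            exact inv_sum_ofReal_le k.succ_pos _ fun i => hl0 _
        _ = (∫⁻ a, ENNReal.ofReal (h a) ∂μ) * ((((k + 1 : ℕ) : ℝ≥0∞) ^ 2)⁻¹ *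
            (((k + 1 : ℕ) : ℝ≥0∞) * ∫⁻ a, (ENNReal.ofReal (l a))⁻¹ ∂μ)) := by
            rw [← lintegral_pi_sum μ (by fun_prop), ← lintegral_const_mul _ (by fun_prop),
              ← lintegral_mul_const _ (by fun_prop)]
            refine lintegral_congr fun a => ?_
            rw [lintegral_const_mul _ (by fun_prop)]
        _ ≤ b * (((k + 1 : ℕ) : ℝ≥0∞)⁻¹ * d) := by
            rw [← mul_assoc (_⁻¹)]
            gcongr
            rw [sq, ENNReal.mul_inv (by simp) (by simp), mul_assoc,
              ENNReal.inv_mul_cancel (by simp) (by simp), mul_one]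
    refine (Finset.sum_le_sum fun j _ => hterm j).trans ?_
    rw [Finset.sum_const, Finset.card_univ, Fintype.card_fin, nsmul_eq_mul, mul_left_comm,
      ← mul_assoc (((k + 2 : ℕ) : ℝ≥0∞))]
    refine mul_le_mul_right (mul_le_mul_left ?_ d) b
    -- The constant 2 in 𝕀_N comes from (k+2)/(k+1) ≤ 2.
    rw [← div_eq_mul_inv]
    refine ENNReal.div_le_of_le_mul ?_
    norm_cast
    omega

end Estimates

/-! ### From races to a bound for a whole batch -/

section Race

variable {α : Type*} {n : ℕ}

/-- The acceptance probability of ensemble rejection sampling for the candidate `j`. -/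
def acceptProb (l : α → ℝ) (c : ℝ) (j : Fin (n + 1)) (z : Fin (n + 1) → α) : ℝ :=
  (∑ k, l (z k)) / (∑ k, l (z k) + c - l (z j))

/-- Since `m` dominates the ratios of `l`, two winners i and j would satisfy both s_i·l_j < s_j·l_i
and its reverse. -/
lemma disjoint_raceEvent {m : α → α → ℝ} {l : α → ℝ} (hml : ∀ a b, l a / l b ≤ m a b) {D : Set α}
    (hDl : ∀ a ∈ D, 0 < l a) {acc : Fin (n + 1) → (Fin (n + 1) → α) → ℝ} :
    Pairwise (Function.onFun Disjoint fun j => raceEvent m D (acc j) j) := by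
  intro i j hij
  rw [Function.onFun, Set.disjoint_left]
  rintro t ⟨hi, hwi, -⟩ ⟨hj, hwj, -⟩
  obtain ⟨i', rfl⟩ := Fin.exists_succAbove_eq hij
  obtain ⟨j', hj'⟩ := Fin.exists_succAbove_eq hij.symm
  have h1 := hwi.2 j'
  have h2 := hwj.2 i'
  rw [hj'] at h1
  have hli := hDl _ hi
  have hlj := hDl _ hj
  have h3 := (mul_le_mul_of_nonneg_left (hml (t.1.1 j) (t.1.1 (j.succAbove i'))) hwi.1.le).trans_lt h1
  have h4 := (mul_le_mul_of_nonneg_left (hml (t.1.1 (j.succAbove i')) (t.1.1 j)) hwj.1.le).trans_lt h2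
  rw [← mul_div_assoc, div_lt_iff₀ (by assumption)] at h3 h4
  linarith

variable [MeasurableSpace α]

/-- Lower bound for the probability that some position of a batch wins the race and is accepted,
through Jensen's inequality for the inverse. -/
lemma le_measure_iUnion_raceEvent (μ : Measure α) [IsProbabilityMeasure μ] {m : α → α → ℝ}
    (hm : Measurable (Function.uncurry m)) {l : α → ℝ} (hl : Measurable l) (hl0 : ∀ a, 0 ≤ l a)
    (hml : ∀ a b, l a / l b ≤ m a b) {c : ℝ} (hc : 1 ≤ c) (hlc : ∀ a, l a ≤ c)
    {D : Set α} (hD : MeasurableSet D) (hDl : ∀ a ∈ D, 0 < l a)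
    (Z : α → (Fin n → α) → ℝ) (hZm : ∀ a, Measurable (Z a)) (hZ0 : ∀ a ∈ D, ∀ r, 0 < Z a r)
    (hZ : ∀ a ∈ D, ∀ r, l a / Z a r ≤
      (∑ i, l (r i) + l a) / (∑ i, l (r i) + c) * (1 / (1 + ∑ i, m (r i) a)))
    (M : α → ℝ) (hM0 : ∀ a ∈ D, 0 < M a)
    (hM : ∀ a ∈ D, ∫⁻ r, ENNReal.ofReal (Z a r) ∂(Measure.pi fun _ => μ)
      ≤ ENNReal.ofReal ((n + 1) * M a)) :
    ∫⁻ a in D, ENNReal.ofReal (l a / M a) ∂μ ≤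
      (((Measure.pi fun _ => μ).prod (Measure.pi fun _ => expMeasure 1)).prod
        (volume.restrict (Set.Icc (0 : ℝ) 1)))
        (⋃ j : Fin (n + 1), raceEvent m D (acceptProb l c j) j) := by
  have hm0 (a b : α) : 0 ≤ m a b := (div_nonneg (hl0 a) (hl0 b)).trans (hml a b)
  have hacc (j : Fin (n + 1)) : Measurable (acceptProb l c j) := by
    unfold acceptProb; fun_prop
  have hacc1 (j : Fin (n + 1)) (z : Fin (n + 1) → α) : acceptProb l c j z ≤ 1 := by
    have h1 := Finset.single_le_sum (f := fun k => l (z k)) (fun i _ => hl0 _) (Finset.mem_univ j)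
    have := hlc (z j)
    exact div_le_one_of_le₀ (by linarith) (by linarith)
  rw [measure_iUnion (disjoint_raceEvent hml hDl)
    fun j => measurableSet_raceEvent hm hD (hacc j) j, tsum_fintype]
  -- By exchangeability each position contributes at least an equal share; `M` is the mean of `Z`
  -- per position.
  have key : ∀ j : Fin (n + 1), ((n + 1 : ℕ) : ℝ≥0∞)⁻¹ * ∫⁻ a in D, ENNReal.ofReal (l a / M a) ∂μ
      ≤ (((Measure.pi fun _ => μ).prod (Measure.pi fun _ => expMeasure 1)).prod
        (volume.restrict (Set.Icc (0 : ℝ) 1))) (raceEvent m D (acceptProb l c j) j) := fun j => by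
    rw [measure_raceEvent μ hm hm0 hD (hacc j) (hacc1 j) j, lintegral_indicator hD,
      ← lintegral_const_mul' _ _ (by simp)]
    refine setLIntegral_mono' hD fun a ha => ?_
    have hMa := hM0 a ha
    have hla := hDl a ha
    calc _ = ENNReal.ofReal (l a) * (ENNReal.ofReal ((n + 1) * M a))⁻¹ := by
          rw [← ENNReal.ofReal_inv_of_pos (by positivity), ← ENNReal.ofReal_mul hla.le,
            ← ENNReal.ofReal_natCast, ← ENNReal.ofReal_inv_of_pos (by positivity),
            ← ENNReal.ofReal_mul (by positivity)]
          congr 1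
          push_cast
          field_simp
      _ ≤ ENNReal.ofReal (l a) * ∫⁻ r, (ENNReal.ofReal (Z a r))⁻¹ ∂(Measure.pi fun _ => μ) := by
          gcongr
          refine (ENNReal.inv_le_inv.mpr (hM a ha)).trans ?_
          exact inv_lintegral_le_lintegral_inv _ (by fun_prop)
            (fun r => by simpa using hZ0 a ha r) fun r => by simp
      _ ≤ _ := by
          rw [← lintegral_const_mul' _ _ (by simp)]
          refine lintegral_mono fun r => ?_
          rw [← ENNReal.ofReal_inv_of_pos (hZ0 a ha r), ← ENNReal.ofReal_mul hla.le,
            ← ENNReal.ofReal_mul' (one_div_nonneg.mpr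
              (add_nonneg zero_le_one (Finset.sum_nonneg fun i _ => hm0 _ _)))]
          refine ENNReal.ofReal_le_ofReal ((hZ a ha r).trans_eq ?_)
          -- With `l a` split off both sums, it cancels in the denominator, and the acceptance
          -- probability becomes (T + l a)/(T + c).
          simp only [acceptProb]
          rw [Fin.sum_univ_succAbove _ j]
          simp only [Fin.insertNth_apply_same, Fin.insertNth_apply_succAbove]
          ring_nf
  refine le_trans ?_ (Finset.sum_le_sum fun j _ => key j)
  rw [Finset.sum_const, Finset.card_univ, Fintype.card_fin, nsmul_eq_mul, ← mul_assoc,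
    ENNReal.mul_inv_cancel (by simp) (by simp), one_mul]

end Race

/-! ### Race events determine the selections of both parties -/

section Selection

lemma argminOn_eq {N : ℕ} [NeZero N] {s : Finset (Fin N)} {f : Fin N → ℝ≥0∞} {j : Fin N}
    (hj : j ∈ s) (hlt : ∀ i ∈ s, i ≠ j → f j < f i) : argminOn s f = j := by
  classical
  have h : (s.filter fun k => ∀ i ∈ s, f k ≤ f i) = {j} := by
    ext k
    simp only [Finset.mem_filter, Finset.mem_singleton]
    constructor
    · rintro ⟨hk, hk'⟩
      by_contra hne
      exact absurd (hk' j hj) (not_le.mpr (hlt k hk hne))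
    · rintro rfl
      refine ⟨hj, fun i hi => ?_⟩
      by_cases hik : i = k
      · rw [hik]
      · exact (hlt i hi hik).le
  have h' : (s.filter fun k => ∀ i ∈ s, f k ≤ f i).Nonempty := by simp [h]
  unfold argminOn
  rw [dif_pos (by convert h')]
  convert Finset.mem_singleton.mp ((Finset.ext_iff.mp h _).mp (Finset.min'_mem _ h'))

/-- Cross-multiplication, except that a competitor of weight zero has score ∞. This requires `0 <
s'`, because 0/0 is 0 in `ℝ≥0∞`; the hypotheses `hs` and `h` provide it. -/
lemma score_lt_score {s s' l l' : ℝ} (hl : 0 < l) (hl' : 0 ≤ l') (hs : 0 < s)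
    (h : s * (l' / l) < s') : score s l < score s' l' := by
  have hs' : 0 < s' := (mul_nonneg hs.le (div_nonneg hl' hl.le)).trans_lt h
  unfold score
  rcases hl'.eq_or_lt with rfl | hl'
  · rw [ENNReal.ofReal_zero, ENNReal.div_zero (by simpa using hs'), ← ENNReal.ofReal_div_of_pos hl]
    exact ENNReal.ofReal_lt_top
  · rw [← ENNReal.ofReal_div_of_pos hl, ← ENNReal.ofReal_div_of_pos hl']
    refine (ENNReal.ofReal_lt_ofReal_iff (by positivity)).mpr ?_
    rw [div_lt_div_iff₀ hl hl']
    rw [← mul_div_assoc, div_lt_iff₀ hl] at h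
    exact h

variable {𝒴 : Type*} {n V : ℕ}

/-- The speed ratios of the encoder's race. -/
def weightRatio (l : 𝒴 → ℝ) (a b : 𝒴 × Fin V) : ℝ := l a.1 / l b.1

/-- The speed ratios of a race that has to be won both for the encoder and for the decoder. -/
def hashRatio (l g : 𝒴 → ℝ) (a b : 𝒴 × Fin V) : ℝ :=
  max (l a.1 / l b.1) (if a.2 = b.2 then g a.1 / g b.1 else 0)

/-- A proposal of the batch strictly wins the race of the encoder and is accepted. -/
def acceptEvent (l : 𝒴 → ℝ) (c : ℝ) (n V : ℕ) : Set (Batch 𝒴 (n + 1) V) :=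
  batchSplit ⁻¹' ⋃ j, raceEvent (weightRatio l) {a | 0 < l a.1} (acceptProb (fun a => l a.1) c j) j

/-- A proposal of the batch strictly wins both races and is accepted. -/
def matchEvent (l g : 𝒴 → ℝ) (c : ℝ) (n V : ℕ) : Set (Batch 𝒴 (n + 1) V) :=
  batchSplit ⁻¹' ⋃ j, raceEvent (hashRatio l g) {a | 0 < l a.1 ∧ 0 < g a.1}
    (acceptProb (fun a => l a.1) c j) j

lemma gumbel_eq_of_race {f q : 𝒴 → ℝ} (hf : ∀ y, 0 ≤ f y) (hq : ∀ y, 0 ≤ q y)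
    {B : Batch 𝒴 (n + 1) V} {j : Fin (n + 1)} {s : Finset (Fin (n + 1))} (hj : j ∈ s)
    (hl : 0 < f (B.1 j).1 / q (B.1 j).1) (hs : 0 < (B.1 j).2.2)
    (h : ∀ i, j.succAbove i ∈ s → (B.1 j).2.2 * ((f (B.1 (j.succAbove i)).1 /
      q (B.1 (j.succAbove i)).1) / (f (B.1 j).1 / q (B.1 j).1)) < (B.1 (j.succAbove i)).2.2) :
    gumbel f q s B = j := by
  refine argminOn_eq hj fun i hi hij => ?_
  obtain ⟨i, rfl⟩ := Fin.exists_succAbove_eq hij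
  exact score_lt_score hl (div_nonneg (hf _) (hq _)) hs (h i hi)

lemma accepts_of_mem_acceptEvent {f q : 𝒴 → ℝ} (hf : ∀ y, 0 ≤ f y) (hq : ∀ y, 0 ≤ q y) {c : ℝ}
    {B : Batch 𝒴 (n + 1) V} (hB : B ∈ acceptEvent (fun y => f y / q y) c n V) :
    Accepts f q c B := by
  obtain ⟨j, hj, hr, hu⟩ := Set.mem_iUnion.mp hB
  have h : gumbel f q Finset.univ B = j :=
    gumbel_eq_of_race hf hq (Finset.mem_univ j) hj hr.1 fun i _ => hr.2 i
  unfold Accepts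
  rw [h]
  exact hu

/-- The maximum in `hashRatio` makes `j` win both races: against everyone for the encoder, and
against the proposals with its own hash for the decoder. Acceptance at index 0 makes this the
transmitted batch. -/
lemma decode_eq_of_mem_matchEvent {f g q : 𝒴 → ℝ} (hf : ∀ y, 0 ≤ f y) (hg : ∀ y, 0 ≤ g y)
    (hq : ∀ y, 0 ≤ q y) {c : ℝ} {W : Randomness 𝒴 (n + 1) V}
    (hW : W 0 ∈ matchEvent (fun y => f y / q y) (fun y => g y / q y) c n V) :
    decode g q W (message f q c W) = ersSelect f q c W := by
  obtain ⟨j, hj, hr, hu⟩ := Set.mem_iUnion.mp hW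
  have h : gumbel f q Finset.univ (W 0) = j :=
    gumbel_eq_of_race hf hq (Finset.mem_univ j) hj.1 hr.1 fun i _ =>
      (mul_le_mul_of_nonneg_left (le_max_left _ _) hr.1.le).trans_lt (hr.2 i)
  have hacc : Accepts f q c (W 0) := by
    unfold Accepts
    rw [h]
    exact hu
  have hidx : batchIndex f q c W = 0 := Nat.sInf_eq_zero.mpr (Or.inl hacc)
  have hsel : ersSelect f q c W = (0, j) := by rw [ersSelect, hidx, h]
  have hmsg : message f q c W = (0, hashAt W (0, j)) := by rw [message, hsel]
  rw [hmsg, hsel, decode]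
  congr 1
  refine gumbel_eq_of_race hg hq (by simp) hj.2 hr.1 fun i hi => ?_
  refine (mul_le_mul_of_nonneg_left ?_ hr.1.le).trans_lt (hr.2 i)
  have heq : hashAt W (0, j.succAbove i) = hashAt W (0, j) := by simpa using hi
  unfold hashRatio
  rw [if_pos (by exact heq)]
  exact le_max_right _ _

end Selection

/-! ### Joint measurability in the source data and the batch -/

section Measurability

variable {𝒴 P : Type*} [MeasurableSpace 𝒴] [MeasurableSpace P] {n V : ℕ}

/-- Copying the parameter into the mark of every proposal turns the parametrised event into the
preimage of a union of race events with fixed data, over the mark space `P × 𝒴 × Fin V`. -/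
lemma measurableSet_matchEvent {l g : P → 𝒴 → ℝ} (hl : Measurable (Function.uncurry l))
    (hg : Measurable (Function.uncurry g)) {c : P → ℝ} (hc : Measurable c) :
    MeasurableSet {t : P × Batch 𝒴 (n + 1) V | t.2 ∈ matchEvent (l t.1) (g t.1) (c t.1) n V} := by
  let F (t : P × Batch 𝒴 (n + 1) V) :
      ((Fin (n + 1) → P × 𝒴 × Fin V) × (Fin (n + 1) → ℝ)) × ℝ :=
    ((fun i => (t.1, (t.2.1 i).1, (t.2.1 i).2.1), fun i => (t.2.1 i).2.2), t.2.2)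
  have hF : Measurable F := by fun_prop
  have hl' : Measurable fun a : P × 𝒴 × Fin V => l a.1 a.2.1 :=
    hl.comp (f := fun a : P × 𝒴 × Fin V => (a.1, a.2.1)) (by fun_prop)
  have hg' : Measurable fun a : P × 𝒴 × Fin V => g a.1 a.2.1 :=
    hg.comp (f := fun a : P × 𝒴 × Fin V => (a.1, a.2.1)) (by fun_prop)
  have hm : Measurable (Function.uncurry fun a b : P × 𝒴 × Fin V =>
      max (l a.1 a.2.1 / l b.1 b.2.1) (if a.2.2 = b.2.2 then g a.1 a.2.1 / g b.1 b.2.1 else 0)) := by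
    refine ((hl'.comp measurable_fst).div (hl'.comp measurable_snd)).max
      (Measurable.ite ?_ ((hg'.comp measurable_fst).div (hg'.comp measurable_snd))
        measurable_const)
    exact measurableSet_eq_fun (by fun_prop) (by fun_prop)
  have hD : MeasurableSet {a : P × 𝒴 × Fin V | 0 < l a.1 a.2.1 ∧ 0 < g a.1 a.2.1} :=
    (measurableSet_lt measurable_const hl').inter (measurableSet_lt measurable_const hg')
  have hacc (j : Fin (n + 1)) : Measurable fun z : Fin (n + 1) → P × 𝒴 × Fin V =>
      (∑ k, l (z k).1 (z k).2.1) /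
        (∑ k, l (z k).1 (z k).2.1 + c (z j).1 - l (z j).1 (z j).2.1) := by
    have (k : Fin (n + 1)) : Measurable fun z : Fin (n + 1) → P × 𝒴 × Fin V =>
      l (z k).1 (z k).2.1 := hl'.comp (measurable_pi_apply k)
    fun_prop
  have := hF (MeasurableSet.iUnion fun j => measurableSet_raceEvent hm hD (hacc j) j)
  convert this using 1
  ext t
  simp only [Set.mem_ofPred_eq, matchEvent, Set.mem_preimage, Set.mem_iUnion]
  rfl

lemma measurableSet_acceptEvent {l : P → 𝒴 → ℝ} (hl : Measurable (Function.uncurry l))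
    {c : P → ℝ} (hc : Measurable c) :
    MeasurableSet {t : P × Batch 𝒴 (n + 1) V | t.2 ∈ acceptEvent (l t.1) (c t.1) n V} := by
  let F (t : P × Batch 𝒴 (n + 1) V) :
      ((Fin (n + 1) → P × 𝒴 × Fin V) × (Fin (n + 1) → ℝ)) × ℝ :=
    ((fun i => (t.1, (t.2.1 i).1, (t.2.1 i).2.1), fun i => (t.2.1 i).2.2), t.2.2)
  have hF : Measurable F := by fun_prop
  have hl' : Measurable fun a : P × 𝒴 × Fin V => l a.1 a.2.1 :=
    hl.comp (f := fun a : P × 𝒴 × Fin V => (a.1, a.2.1)) (by fun_prop)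
  have hm : Measurable (Function.uncurry fun a b : P × 𝒴 × Fin V =>
      l a.1 a.2.1 / l b.1 b.2.1) := (hl'.comp measurable_fst).div (hl'.comp measurable_snd)
  have hacc (j : Fin (n + 1)) : Measurable fun z : Fin (n + 1) → P × 𝒴 × Fin V =>
      (∑ k, l (z k).1 (z k).2.1) /
        (∑ k, l (z k).1 (z k).2.1 + c (z j).1 - l (z j).1 (z j).2.1) := by
    have (k : Fin (n + 1)) : Measurable fun z : Fin (n + 1) → P × 𝒴 × Fin V =>
      l (z k).1 (z k).2.1 := hl'.comp (measurable_pi_apply k)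
    fun_prop
  have := hF (MeasurableSet.iUnion fun j => measurableSet_raceEvent hm
    (measurableSet_lt (measurable_const (a := (0 : ℝ))) hl') (hacc j) j)
  convert this using 1
  ext t
  simp only [Set.mem_ofPred_eq, acceptEvent, Set.mem_preimage, Set.mem_iUnion]
  rfl

end Measurability

/-! ### The acceptance probability of a batch -/

section Probability

variable {𝒴 : Type*} [MeasurableSpace 𝒴] (Q : Measure 𝒴) {n V : ℕ} [NeZero V]

instance : IsProbabilityMeasure (uniformOn (Set.univ : Set (Fin V))) :=
  isProbabilityMeasure_uniformOn Set.finite_univ Set.univ_nonempty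

/-- The hash is independent of the sample and hits `v` with probability 1/V: this is the origin of
V⁻¹ in the error bound. -/
lemma lintegral_hash {F : 𝒴 → ℝ≥0∞} (hF : Measurable F) (v : Fin V) :
    ∫⁻ a, (if a.2 = v then F a.1 else 0) ∂(Q.prod (uniformOn (Set.univ : Set (Fin V))))
      = ENNReal.ofReal (V : ℝ)⁻¹ * ∫⁻ y, F y ∂Q := by
  have h : ∀ a : 𝒴 × Fin V, (if a.2 = v then F a.1 else 0)
      = F a.1 * ({v} : Set (Fin V)).indicator 1 a.2 := fun a => by
    by_cases ha : a.2 = v <;> simp [ha]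
  simp_rw [h]
  have hV : (0 : ℝ) < V := by exact_mod_cast Nat.pos_of_ne_zero (NeZero.ne V)
  rw [lintegral_prod_mul hF.aemeasurable (by fun_prop), lintegral_indicator_one (by simp),
    uniformOn_univ, mul_comm, ENNReal.ofReal_inv_of_pos hV]
  simp

lemma lintegral_comp_fst {F : 𝒴 → ℝ≥0∞} (hF : Measurable F) :
    ∫⁻ a, F a.1 ∂(Q.prod (uniformOn (Set.univ : Set (Fin V)))) = ∫⁻ y, F y ∂Q :=
  measurePreserving_fst.lintegral_comp hF

variable [IsProbabilityMeasure Q]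

/-- Take Z = T + c, with mean n + c ≤ 2(n + 1); so the constant M = 2 is admissible, and `l / 2`
integrates to 1/2. -/
lemma le_batchLaw_acceptEvent {l : 𝒴 → ℝ} (hl : Measurable l) (hl0 : ∀ y, 0 ≤ l y)
    (hl1 : ∫⁻ y, ENNReal.ofReal (l y) ∂Q = 1) {c : ℝ} (hc : 1 ≤ c) (hlc : ∀ y, l y ≤ c)
    (hcn : c ≤ n + 1) : 2⁻¹ ≤ batchLaw Q (n + 1) V (acceptEvent l c n V) := by
  have hlα : Measurable fun a : 𝒴 × Fin V => l a.1 := by fun_prop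
  have hm : Measurable (Function.uncurry (weightRatio (V := V) l)) := by
    unfold weightRatio Function.uncurry; fun_prop
  have hD : MeasurableSet {a : 𝒴 × Fin V | 0 < l a.1} := measurableSet_lt measurable_const hlα
  have hacc (j : Fin (n + 1)) : Measurable (acceptProb (fun a : 𝒴 × Fin V => l a.1) c j) := by
    unfold acceptProb; fun_prop
  rw [acceptEvent, (measurePreserving_batchSplit Q).measure_preimage
    (MeasurableSet.iUnion fun j => measurableSet_raceEvent hm hD (hacc j) j).nullMeasurableSet]
  refine le_trans ?_ (le_measure_iUnion_raceEvent (Q.prod (uniformOn Set.univ)) hm hlα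
    (fun a => hl0 _) (fun a b => le_rfl) hc (fun a => hlc _) hD (fun a ha => ha)
    (fun a r => ∑ i, l (r i).1 + c) (fun a => by fun_prop) ?_ ?_ (fun _ => 2) (by simp) ?_)
  · rw [setLIntegral_eq_of_support_subset]
    · have (a : 𝒴 × Fin V) : ENNReal.ofReal (l a.1 / 2) = ENNReal.ofReal (l a.1) * 2⁻¹ := by
        rw [ENNReal.ofReal_div_of_pos two_pos, div_eq_mul_inv]; simp
      simp_rw [this]
      rw [lintegral_mul_const _ (by fun_prop),
        lintegral_comp_fst Q (F := fun y => ENNReal.ofReal (l y)) (by fun_prop), hl1, one_mul]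
    · intro a ha
      by_contra h
      have h0 : l a.1 = 0 := le_antisymm (not_lt.mp h) (hl0 _)
      simp [h0] at ha
  · exact fun a _ r => by
      have : 0 ≤ ∑ i, l (r i).1 := Finset.sum_nonneg fun i _ => hl0 _
      linarith
  · intro a ha r
    have ha' : 0 < l a.1 := ha
    have hT : 0 ≤ ∑ i, l (r i).1 := Finset.sum_nonneg fun i _ => hl0 _
    have hTc : 0 < ∑ i, l (r i).1 + c := by linarith
    simp only [weightRatio]
    rw [← Finset.sum_div]
    refine le_of_eq ?_
    field_simp
    ring
  · intro a _
    have (r : Fin n → 𝒴 × Fin V) : ENNReal.ofReal (∑ i, l (r i).1 + c)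
        = ∑ i, ENNReal.ofReal (l (r i).1) + ENNReal.ofReal c := by
      rw [ENNReal.ofReal_add (Finset.sum_nonneg fun i _ => hl0 _) (by linarith),
        ENNReal.ofReal_sum_of_nonneg fun i _ => hl0 _]
    simp_rw [this]
    rw [lintegral_add_right _ measurable_const, lintegral_pi_sum _
      (f := fun a : 𝒴 × Fin V => ENNReal.ofReal (l a.1)) (by fun_prop),
      lintegral_comp_fst Q (F := fun y => ENNReal.ofReal (l y)) (by fun_prop), hl1, lintegral_const,
      measure_univ, mul_one, mul_one, ← ENNReal.ofReal_natCast,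
      ← ENNReal.ofReal_add (by positivity) (by linarith)]
    exact ENNReal.ofReal_le_ofReal (by linarith)

end Probability

/-! ### The probability that both parties agree on the first batch -/

section Probability

variable {𝒴 : Type*} [MeasurableSpace 𝒴] (Q : Measure 𝒴) [IsProbabilityMeasure Q] {n V : ℕ}
  [NeZero V]

/-- The only loss beyond `hSle` is (T+c)/(T+l) ≤ 1 + c/(T+l). It separates a part linear in G, whose
mean is immediate, from G/(T+l), which d₂ controls. -/
lemma div_add_le_of_ratio_le {l g T G S c : ℝ} (hl : 0 < l) (hg : 0 < g) (hT : 0 ≤ T)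
    (hG : 0 ≤ G) (hS : 0 ≤ S) (hc : 1 ≤ c) (hSle : S ≤ T / l + G / g) :
    l / (T + c + l / g * G + l / g * c * (G / (T + l))) ≤
      (T + l) / (T + c) * (1 / (1 + S)) := by
  have hTc : 0 < T + c := by linarith
  have hTl : 0 < T + l := by linarith
  have h1 : (T + l) / (T + c) * (1 / (1 + (T / l + G / g))) ≤
      (T + l) / (T + c) * (1 / (1 + S)) := by gcongr
  refine le_trans ?_ h1
  have h2 : (T + l) / (T + c) * (1 / (1 + (T / l + G / g)))
      = l / (T + c + l / g * G * ((T + c) / (T + l))) := by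
    field_simp
    ring
  rw [h2]
  have h3 : (T + c) / (T + l) ≤ 1 + c / (T + l) := by
    rw [div_le_iff₀ hTl, add_mul, div_mul_cancel₀ _ hTl.ne']
    linarith
  have h4 : l / g * G * ((T + c) / (T + l)) ≤ l / g * G * (1 + c / (T + l)) := by gcongr
  refine div_le_div_of_nonneg_left hl.le (by positivity) ?_
  calc _ ≤ T + c + l / g * G * (1 + c / (T + l)) := by linarith
    _ = _ := by ring

/-- Lower bound for the probability that the first batch is accepted and both parties select the
same proposal. -/
lemma le_batchLaw_matchEvent {l g : 𝒴 → ℝ} (hl : Measurable l) (hg : Measurable g)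
    (hl0 : ∀ y, 0 ≤ l y) (hg0 : ∀ y, 0 ≤ g y) (hl1 : ∫⁻ y, ENNReal.ofReal (l y) ∂Q ≤ 1)
    (hg1 : ∫⁻ y, ENNReal.ofReal (g y) ∂Q ≤ 1) {c ω ε : ℝ} (hc : 1 ≤ c) (hlc : ∀ y, l y ≤ c)
    (hgω : ∀ y, g y ≤ ω) (hε : 0 < ε) {d : ℝ≥0∞}
    (hd : ∫⁻ y, (ENNReal.ofReal (l y))⁻¹ ∂Q ≤ d)
    (h1 : mu1 c (n + 1) ≤ ENNReal.ofReal ε) (h2 : mu2 c ω (n + 1) d ≤ ENNReal.ofReal ε) :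
    ∫⁻ y in {y | 0 < l y ∧ 0 < g y},
        ENNReal.ofReal (l y / (1 + ε + (1 + ε) * (V : ℝ)⁻¹ * (l y / g y))) ∂Q
      ≤ batchLaw Q (n + 1) V (matchEvent l g c n V) := by
  have hlα : Measurable fun a : 𝒴 × Fin V => l a.1 := by fun_prop
  have hgα : Measurable fun a : 𝒴 × Fin V => g a.1 := by fun_prop
  have hm : Measurable (Function.uncurry (hashRatio (V := V) l g)) := by
    unfold hashRatio Function.uncurry
    refine ((hlα.comp measurable_fst).div (hlα.comp measurable_snd)).max
      (Measurable.ite ?_ ((hgα.comp measurable_fst).div (hgα.comp measurable_snd))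
        measurable_const)
    exact measurableSet_eq_fun (by fun_prop) (by fun_prop)
  have hD' : MeasurableSet {y : 𝒴 | 0 < l y ∧ 0 < g y} :=
    (measurableSet_lt measurable_const hl).inter (measurableSet_lt measurable_const hg)
  have hD : MeasurableSet {a : 𝒴 × Fin V | 0 < l a.1 ∧ 0 < g a.1} := measurable_fst hD'
  have hacc (j : Fin (n + 1)) : Measurable (acceptProb (fun a : 𝒴 × Fin V => l a.1) c j) := by
    unfold acceptProb; fun_prop
  have hV : (0 : ℝ) < V := by exact_mod_cast Nat.pos_of_ne_zero (NeZero.ne V)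
  have hω0 : 0 ≤ ω := by
    obtain ⟨y⟩ : Nonempty 𝒴 := nonempty_of_isProbabilityMeasure Q
    exact (hg0 y).trans (hgω y)
  have hgm (v : Fin V) : Measurable fun a : 𝒴 × Fin V => if a.2 = v then g a.1 else 0 :=
    Measurable.ite (measurableSet_eq_fun (by fun_prop) (by fun_prop)) hgα measurable_const
  have hgr (v : Fin V) (i : Fin n) :
      Measurable fun r : Fin n → 𝒴 × Fin V => if (r i).2 = v then g (r i).1 else 0 :=
    (hgm v).comp (measurable_pi_apply i)
  have hg0' (v : Fin V) (a : 𝒴 × Fin V) : 0 ≤ if a.2 = v then g a.1 else 0 := by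
    split_ifs <;> simp [hg0]
  rw [matchEvent, (measurePreserving_batchSplit Q).measure_preimage
    (MeasurableSet.iUnion fun j => measurableSet_raceEvent hm hD (hacc j) j).nullMeasurableSet]
  refine le_trans (le_of_eq ?_) (le_measure_iUnion_raceEvent (Q.prod (uniformOn Set.univ)) hm hlα
    (fun a => hl0 _) (fun a b => le_max_left _ _) hc (fun a => hlc _) hD (fun a ha => ha.1)
    (fun a r => ∑ i, l (r i).1 + c + l a.1 / g a.1 * (∑ i, if (r i).2 = a.2 then g (r i).1 else 0)
      + l a.1 / g a.1 * c *
        ((∑ i, if (r i).2 = a.2 then g (r i).1 else 0) / (∑ i, l (r i).1 + l a.1)))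
    (fun a => ?_) (fun a ha r => ?_) (fun a ha r => ?_)
    (fun a => 1 + ε + (1 + ε) * (V : ℝ)⁻¹ * (l a.1 / g a.1)) (fun a ha => ?_) (fun a ha => ?_))
  · exact (((measurePreserving_fst (μ := Q) (ν := uniformOn (Set.univ : Set (Fin V)))
      ).setLIntegral_comp_preimage hD' (f := fun y => ENNReal.ofReal
        (l y / (1 + ε + (1 + ε) * (V : ℝ)⁻¹ * (l y / g y)))) (by fun_prop)).symm)
  · have := hgr a.2
    fun_prop
  · have ha1 : 0 < l a.1 := ha.1
    have ha2 : 0 < g a.1 := ha.2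
    have hT : 0 ≤ ∑ i, l (r i).1 := Finset.sum_nonneg fun i _ => hl0 _
    have hG : 0 ≤ ∑ i, if (r i).2 = a.2 then g (r i).1 else 0 :=
      Finset.sum_nonneg fun i _ => hg0' a.2 (r i)
    positivity
  · refine div_add_le_of_ratio_le ha.1 ha.2 (Finset.sum_nonneg fun i _ => hl0 _)
      (Finset.sum_nonneg fun i _ => hg0' a.2 (r i))
      (Finset.sum_nonneg fun i _ => le_max_of_le_left (div_nonneg (hl0 _) (hl0 _))) hc ?_
    rw [Finset.sum_div, Finset.sum_div, ← Finset.sum_add_distrib]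
    refine Finset.sum_le_sum fun i _ => ?_
    unfold hashRatio
    have h3 := div_nonneg (hl0 (r i).1) (hl0 a.1)
    have h4 := div_nonneg (hg0 (r i).1) (hg0 a.1)
    split_ifs
    · exact max_le_add_of_nonneg h3 h4
    · rw [zero_div, add_zero, max_eq_left h3]
  · have ha1 : 0 < l a.1 := ha.1
    have ha2 : 0 < g a.1 := ha.2
    positivity
  · have ha1 : 0 < l a.1 := ha.1
    have ha2 : 0 < g a.1 := ha.2
    have hA : 0 < l a.1 / g a.1 := div_pos ha1 ha2
    have hT (r : Fin n → 𝒴 × Fin V) : 0 ≤ ∑ i, l (r i).1 := Finset.sum_nonneg fun i _ => hl0 _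
    have hG (r : Fin n → 𝒴 × Fin V) : 0 ≤ ∑ i, if (r i).2 = a.2 then g (r i).1 else 0 :=
      Finset.sum_nonneg fun i _ => hg0' a.2 (r i)
    have hsplit (r : Fin n → 𝒴 × Fin V) : ENNReal.ofReal (∑ i, l (r i).1 + c +
        l a.1 / g a.1 * (∑ i, if (r i).2 = a.2 then g (r i).1 else 0) + l a.1 / g a.1 * c *
        ((∑ i, if (r i).2 = a.2 then g (r i).1 else 0) / (∑ i, l (r i).1 + l a.1)))
        = ∑ i, ENNReal.ofReal (l (r i).1) + ENNReal.ofReal c + ENNReal.ofReal (l a.1 / g a.1) *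
          (∑ i, ENNReal.ofReal (if (r i).2 = a.2 then g (r i).1 else 0)) +
          ENNReal.ofReal (l a.1 / g a.1 * c) * ENNReal.ofReal
            ((∑ i, if (r i).2 = a.2 then g (r i).1 else 0) / (∑ i, l (r i).1 + l a.1)) := by
      have := hT r
      have := hG r
      rw [ENNReal.ofReal_add (by positivity) (by positivity),
        ENNReal.ofReal_add (by positivity) (by positivity),
        ENNReal.ofReal_add (by positivity) (by positivity), ENNReal.ofReal_mul hA.le,
        ENNReal.ofReal_mul (by positivity), ENNReal.ofReal_sum_of_nonneg fun i _ => hl0 _,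
        ENNReal.ofReal_sum_of_nonneg fun i _ => hg0' a.2 (r i)]
    simp_rw [hsplit]
    have hgm' := hgm a.2
    have hgr' := hgr a.2
    rw [lintegral_add_left (by fun_prop), lintegral_add_left (by fun_prop),
      lintegral_add_left (by fun_prop), lintegral_const_mul _ (by fun_prop),
      lintegral_const_mul _ (by fun_prop), lintegral_const, measure_univ, mul_one,
      lintegral_pi_sum _ (f := fun a : 𝒴 × Fin V => ENNReal.ofReal (l a.1)) (by fun_prop),
      lintegral_pi_sum _ (f := fun b : 𝒴 × Fin V => ENNReal.ofReal (if b.2 = a.2 then g b.1 else 0))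
        (by fun_prop), lintegral_comp_fst Q (F := fun y => ENNReal.ofReal (l y)) (by fun_prop)]
    have hhash : ∫⁻ b, ENNReal.ofReal (if b.2 = a.2 then g b.1 else 0)
        ∂(Q.prod (uniformOn (Set.univ : Set (Fin V)))) ≤ ENNReal.ofReal (V : ℝ)⁻¹ := by
      have (b : 𝒴 × Fin V) : ENNReal.ofReal (if b.2 = a.2 then g b.1 else 0)
          = if b.2 = a.2 then ENNReal.ofReal (g b.1) else 0 := by split_ifs <;> simp
      simp_rw [this]
      rw [lintegral_hash Q (F := fun y => ENNReal.ofReal (g y)) (by fun_prop)]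
      exact mul_le_of_le_one_right' hg1
    have hhash2 : ∫⁻ b, ENNReal.ofReal (if b.2 = a.2 then g b.1 else 0) *
        (ENNReal.ofReal (l b.1))⁻¹ ∂(Q.prod (uniformOn (Set.univ : Set (Fin V))))
          ≤ ENNReal.ofReal (V : ℝ)⁻¹ * (ENNReal.ofReal ω * d) := by
      have (b : 𝒴 × Fin V) : ENNReal.ofReal (if b.2 = a.2 then g b.1 else 0) *
          (ENNReal.ofReal (l b.1))⁻¹
          = if b.2 = a.2 then ENNReal.ofReal (g b.1) * (ENNReal.ofReal (l b.1))⁻¹ else 0 := by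
        split_ifs <;> simp
      simp_rw [this]
      rw [lintegral_hash Q (F := fun y => ENNReal.ofReal (g y) * (ENNReal.ofReal (l y))⁻¹)
        (by fun_prop)]
      gcongr
      -- The ratio bound for the decoder's weight enters only here; it serves the case of a single
      -- competitor.
      calc _ ≤ ∫⁻ y, ENNReal.ofReal ω * (ENNReal.ofReal (l y))⁻¹ ∂Q := by
            gcongr with y
            exact hgω y
        _ ≤ _ := by
            rw [lintegral_const_mul _ (by fun_prop)]
            gcongr
    have hfrac := lintegral_sum_div_le (Q.prod (uniformOn (Set.univ : Set (Fin V)))) hlα hgm'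
      (fun a => hl0 _) (hg0' a.2) hhash
      (by rwa [lintegral_comp_fst Q (F := fun y => (ENNReal.ofReal (l y))⁻¹) (by fun_prop)])
      hhash2 (n := n) ha1
    have hmu2 : ENNReal.ofReal (l a.1 / g a.1 * c) *
        (ENNReal.ofReal (V : ℝ)⁻¹ * (ENNReal.ofReal (indicatorCoeff (n + 1) ω 2) * d)) ≤
        ENNReal.ofReal (l a.1 / g a.1 * (V : ℝ)⁻¹ * (n + 1) * ε) := by
      have hI : 0 ≤ indicatorCoeff (n + 1) ω 2 := by
        unfold indicatorCoeff
        split_ifs <;> linarith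
      calc _ = ENNReal.ofReal (l a.1 / g a.1 * (V : ℝ)⁻¹ * (n + 1)) * mu2 c ω (n + 1) d := by
            rw [mu2, ← mul_assoc, ← mul_assoc, ← mul_assoc, ← ENNReal.ofReal_mul (by positivity),
              ← ENNReal.ofReal_mul (by positivity), ← ENNReal.ofReal_mul (by positivity)]
            congr 2
            push_cast
            field_simp
        _ ≤ _ := by
            rw [ENNReal.ofReal_mul (q := ε) (by positivity)]
            exact mul_le_mul_right h2 _
    have hmu1 : 3 * c ≤ ε * (n + 1) := by
      rw [mu1, ENNReal.ofReal_le_ofReal_iff hε.le, div_le_iff₀ (by positivity)] at h1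
      exact_mod_cast h1
    calc _ ≤ n * 1 + ENNReal.ofReal c +
          ENNReal.ofReal (l a.1 / g a.1) * (n * ENNReal.ofReal (V : ℝ)⁻¹) +
          ENNReal.ofReal (l a.1 / g a.1 * (V : ℝ)⁻¹ * (n + 1) * ε) := by
          refine add_le_add (by gcongr) (le_trans ?_ hmu2)
          gcongr
      _ = ENNReal.ofReal (n * 1 + c + l a.1 / g a.1 * (n * (V : ℝ)⁻¹) +
          l a.1 / g a.1 * (V : ℝ)⁻¹ * (n + 1) * ε) := by
          rw [ENNReal.ofReal_add (by positivity) (by positivity),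
            ENNReal.ofReal_add (by positivity) (by positivity),
            ENNReal.ofReal_add (by positivity) (by positivity),
            ENNReal.ofReal_mul hA.le, ENNReal.ofReal_mul (Nat.cast_nonneg n),
            ENNReal.ofReal_mul (Nat.cast_nonneg n), ENNReal.ofReal_natCast, ENNReal.ofReal_one]
      _ ≤ _ := by
          refine ENNReal.ofReal_le_ofReal ?_
          -- By `hmu1`, n + c ≤ (n+1)(1+ε); the terms with l/g add up to at most (n+1)(1+ε)V⁻¹·l/g.
          have : 0 ≤ l a.1 / g a.1 * (V : ℝ)⁻¹ := by positivity
          nlinarith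

end Probability

/-! ### Passing between densities and weights -/

section Densities

lemma ratio_le {𝒴 : Type*} {f q : 𝒴 → ℝ} (hq0 : ∀ y, 0 ≤ q y) {c : ℝ} (hc : 0 ≤ c)
    (hfq : ∀ y, f y ≤ c * q y) (y : 𝒴) :
    f y / q y ≤ c := by
  rcases (hq0 y).eq_or_lt with h0 | h0
  · simpa [← h0] using hc
  · exact (div_le_iff₀ h0).mpr (hfq y)

variable {𝒴 : Type*} [MeasurableSpace 𝒴] {ν Q : Measure 𝒴} {f q : 𝒴 → ℝ}

/-- The cancellation q·(f/q) = f survives at zeros of `q`, since the bounding condition forces `f`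
to vanish there. -/
lemma lintegral_ratio_mul (hf : Measurable f) (hf0 : ∀ y, 0 ≤ f y) (hq : Measurable q)
    (hq0 : ∀ y, 0 ≤ q y) (hQ : Q = ν.withDensity fun y => ENNReal.ofReal (q y)) {c : ℝ}
    (hfq : ∀ y, f y ≤ c * q y) {h : 𝒴 → ℝ≥0∞} (hh : Measurable h) :
    ∫⁻ y, ENNReal.ofReal (f y / q y) * h y ∂Q = ∫⁻ y, ENNReal.ofReal (f y) * h y ∂ν := by
  rw [hQ, lintegral_withDensity_eq_lintegral_mul _ (by fun_prop) (by fun_prop)]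
  refine lintegral_congr fun y => ?_
  rw [Pi.mul_apply, ← mul_assoc, ← ENNReal.ofReal_mul (hq0 y)]
  rcases (hq0 y).eq_or_lt with h0 | h0
  · have : f y = 0 := le_antisymm (by simpa [← h0] using hfq y) (hf0 y)
    simp [← h0, this]
  · rw [mul_div_cancel₀ _ h0.ne']

lemma lintegral_inv_ratio_le_d2 (hf : Measurable f) (hq : Measurable q) (hq0 : ∀ y, 0 ≤ q y)
    (hQ : Q = ν.withDensity fun y => ENNReal.ofReal (q y)) :
    ∫⁻ y, (ENNReal.ofReal (f y / q y))⁻¹ ∂Q ≤ d2 Q q f := by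
  rw [d2, hQ, lintegral_withDensity_eq_lintegral_mul _ (by fun_prop) (by fun_prop),
    lintegral_withDensity_eq_lintegral_mul _ (by fun_prop) (by fun_prop)]
  refine lintegral_mono fun y => ?_
  rw [Pi.mul_apply, Pi.mul_apply]
  rcases (hq0 y).eq_or_lt with h0 | h0
  · simp [← h0]
  · rw [ENNReal.ofReal_div_of_pos h0, ENNReal.inv_div (by simp) (by simp [h0])]

end Densities

/-! ### The posterior density used by the decoder -/

section Decoder

variable {𝒳 𝒳' 𝒴 : Type*} [MeasurableSpace 𝒳] [MeasurableSpace 𝒳'] (PX : Measure 𝒳)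
  [IsProbabilityMeasure PX] (η : Kernel 𝒳 𝒳') [IsMarkovKernel η] {p : 𝒳 → 𝒴 → ℝ} {q : 𝒴 → ℝ}

lemma lintegral_eq_lintegral_density_mul [MeasurableSpace 𝒴] {κ : Kernel 𝒳 𝒴} {ν : Measure 𝒴}
    (hp : Measurable (Function.uncurry p))
    (hκ : ∀ x, κ x = ν.withDensity fun y => ENNReal.ofReal (p x y)) (x : 𝒳) {h : 𝒴 → ℝ≥0∞}
    (hh : Measurable h) : ∫⁻ y, h y ∂κ x = ∫⁻ y, ENNReal.ofReal (p x y) * h y ∂ν := by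
  have : Measurable fun y => p x y := hp.comp (f := fun y => (x, y)) (by fun_prop)
  rw [hκ, lintegral_withDensity_eq_lintegral_mul _ (by fun_prop) hh]
  rfl

lemma lintegral_tripleLaw [MeasurableSpace 𝒴] {κ : Kernel 𝒳 𝒴} [IsMarkovKernel κ]
    {F : 𝒳 × 𝒳' × 𝒴 → ℝ≥0∞} (hF : Measurable F) :
    ∫⁻ t, F t ∂(tripleLaw PX η κ) = ∫⁻ s, ∫⁻ y, F (s.1, s.2, y) ∂κ s.1 ∂(PX ⊗ₘ η) := by
  rw [tripleLaw, Measure.lintegral_compProd hF, Measure.lintegral_compProd]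
  · refine lintegral_congr fun x => ?_
    rw [Kernel.lintegral_prod _ _ _ (by fun_prop)]
  · exact Measurable.lintegral_kernel_prod_right' (κ := κ.comap Prod.fst measurable_fst)
      (f := fun s : (𝒳 × 𝒳') × 𝒴 => F (s.1.1, s.1.2, s.2)) (by fun_prop)

section Nonneg

variable [StandardBorelSpace 𝒳] [Nonempty 𝒳]

lemma decoderDensity_nonneg (hp0 : ∀ x y, 0 ≤ p x y) (x' : 𝒳') (y : 𝒴) :
    0 ≤ decoderDensity PX η p x' y := integral_nonneg fun x => hp0 x y

lemma decoderDensity_le (hp0 : ∀ x y, 0 ≤ p x y) {c : ℝ}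
    (hpq : ∀ x y, p x y ≤ c * q y) (x' : 𝒳') (y : 𝒴) :
    decoderDensity PX η p x' y ≤ c * q y := by
  have h := integral_mono_of_nonneg (μ := posterior η PX x') (ae_of_all _ fun x => hp0 x y)
    (integrable_const (c * q y)) (ae_of_all _ fun x => hpq x y)
  rw [integral_const, probReal_univ, one_smul] at h
  exact h

end Nonneg

variable [StandardBorelSpace 𝒳] [Nonempty 𝒳] [MeasurableSpace 𝒴] {κ : Kernel 𝒳 𝒴} {ν : Measure 𝒴}

lemma ofReal_decoderDensity (hp : Measurable (Function.uncurry p)) (hp0 : ∀ x y, 0 ≤ p x y) {c : ℝ}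
    (hpq : ∀ x y, p x y ≤ c * q y) (x' : 𝒳') (y : 𝒴) :
    ENNReal.ofReal (decoderDensity PX η p x' y)
      = ∫⁻ x, ENNReal.ofReal (p x y) ∂(posterior η PX x') := by
  have hpy : Measurable fun x => p x y :=
    hp.comp (f := fun x => (x, y)) (by fun_prop)
  refine ofReal_integral_eq_lintegral_ofReal ?_ (ae_of_all _ fun x => hp0 x y)
  refine Integrable.of_bound hpy.aestronglyMeasurable (c * q y) (ae_of_all _ fun x => ?_)
  rw [Real.norm_of_nonneg (hp0 x y)]
  exact hpq x y

lemma measurable_decoderDensity (hp : Measurable (Function.uncurry p)) (hp0 : ∀ x y, 0 ≤ p x y)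
    {c : ℝ} (hpq : ∀ x y, p x y ≤ c * q y) :
    Measurable (Function.uncurry (decoderDensity PX η p)) := by
  have h : Function.uncurry (decoderDensity PX η p) = fun t : 𝒳' × 𝒴 =>
      (∫⁻ x, ENNReal.ofReal (p x t.2) ∂((posterior η PX).prodMkRight 𝒴 t)).toReal := by
    funext t
    rw [Kernel.prodMkRight_apply, ← ofReal_decoderDensity PX η hp hp0 hpq,
      ENNReal.toReal_ofReal (decoderDensity_nonneg PX η hp0 _ _)]
    rfl
  rw [h]
  refine (Measurable.lintegral_kernel_prod_right' (κ := (posterior η PX).prodMkRight 𝒴)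
    (f := fun s : (𝒳' × 𝒴) × 𝒳 => ENNReal.ofReal (p s.2 s.1.2)) ?_).ennreal_toReal
  exact (hp.comp (f := fun s : (𝒳' × 𝒴) × 𝒳 => (s.2, s.1.2)) (by fun_prop)).ennreal_ofReal

/-- By Tonelli, `decoderDensity` is the density of the posterior mixture of `κ`. With `h = 1` this
gives it total mass 1; with an indicator it shows that its zero set is null. -/
lemma lintegral_decoderDensity_mul [SigmaFinite ν] [IsSFiniteKernel κ]
    (hp : Measurable (Function.uncurry p))
    (hp0 : ∀ x y, 0 ≤ p x y) (hκ : ∀ x, κ x = ν.withDensity fun y => ENNReal.ofReal (p x y)) {c : ℝ}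
    (hpq : ∀ x y, p x y ≤ c * q y) (x' : 𝒳') {h : 𝒴 → ℝ≥0∞} (hh : Measurable h) :
    ∫⁻ x, ∫⁻ y, h y ∂κ x ∂(posterior η PX x')
      = ∫⁻ y, ENNReal.ofReal (decoderDensity PX η p x' y) * h y ∂ν := by
  simp_rw [lintegral_eq_lintegral_density_mul hp hκ _ hh]
  rw [lintegral_lintegral_swap]
  · refine lintegral_congr fun y => ?_
    have : Measurable fun x => p x y := hp.comp (f := fun x => (x, y)) (by fun_prop)
    rw [lintegral_mul_const _ (by fun_prop), ofReal_decoderDensity PX η hp hp0 hpq]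
  · exact (hp.ennreal_ofReal.mul (hh.comp measurable_snd)).aemeasurable

lemma lintegral_compProd_eq_posterior {F : 𝒳 × 𝒳' → ℝ≥0∞} (hF : Measurable F) :
    ∫⁻ s, F s ∂(PX ⊗ₘ η) = ∫⁻ x', ∫⁻ x, F (x, x') ∂(posterior η PX x') ∂(η ∘ₘ PX) := by
  have h := compProd_posterior_eq_map_swap (μ := PX) (κ := η)
  have h1 : ∫⁻ s, F s ∂(PX ⊗ₘ η) = ∫⁻ s, F s.swap ∂((PX ⊗ₘ η).map Prod.swap) := by
    rw [lintegral_map (by fun_prop) measurable_swap]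
    simp
  rw [h1, ← h, Measure.lintegral_compProd (by fun_prop)]
  rfl

/-- A law does not charge the zeros of its density. For the decoder's density, the joint law is
first disintegrated along X' by Bayes' rule. Positivity makes the logarithms in `infoDensity`
genuine. -/
lemma ae_tripleLaw_pos [SigmaFinite ν] [IsMarkovKernel κ] (hp : Measurable (Function.uncurry p))
    (hp0 : ∀ x y, 0 ≤ p x y) (hκ : ∀ x, κ x = ν.withDensity fun y => ENNReal.ofReal (p x y)) {c : ℝ}
    (hpq : ∀ x y, p x y ≤ c * q y) :
    ∀ᵐ t ∂(tripleLaw PX η κ), 0 < p t.1 t.2.2 ∧ 0 < decoderDensity PX η p t.2.1 t.2.2 := by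
  have hg := measurable_decoderDensity PX η hp hp0 hpq
  have hmp : Measurable fun t : 𝒳 × 𝒳' × 𝒴 => p t.1 t.2.2 :=
    hp.comp (f := fun t : 𝒳 × 𝒳' × 𝒴 => (t.1, t.2.2)) (by fun_prop)
  have hmg : Measurable fun t : 𝒳 × 𝒳' × 𝒴 => decoderDensity PX η p t.2.1 t.2.2 :=
    hg.comp (f := fun t : 𝒳 × 𝒳' × 𝒴 => (t.2.1, t.2.2)) (by fun_prop)
  refine Filter.Eventually.and ?_ ?_
  · have hS := measurableSet_le hmp (measurable_const (a := (0 : ℝ)))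
    have h0 : tripleLaw PX η κ {t | p t.1 t.2.2 ≤ 0} = 0 := by
      rw [← lintegral_indicator_one hS, lintegral_tripleLaw PX η (measurable_one.indicator hS)]
      have (x : 𝒳) (x' : 𝒳') : ∫⁻ y, ({t : 𝒳 × 𝒳' × 𝒴 | p t.1 t.2.2 ≤ 0}.indicator 1 (x, x', y)
          : ℝ≥0∞) ∂κ x = 0 := by
        have hSx : MeasurableSet {y | p x y ≤ 0} :=
          measurableSet_le (hp.comp (f := fun y => (x, y)) (by fun_prop)) measurable_const
        refine (lintegral_eq_lintegral_density_mul hp hκ x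
          (measurable_one.indicator hSx)).trans ?_
        refine (lintegral_congr fun y => ?_).trans lintegral_zero
        by_cases h : p x y ≤ 0
        · simp [ENNReal.ofReal_of_nonpos h]
        · simp [Set.indicator, h]
      simp [this]
    filter_upwards [measure_eq_zero_iff_ae_notMem.mp h0] with t ht
    exact not_le.mp ht
  · have hS := measurableSet_le hmg (measurable_const (a := (0 : ℝ)))
    have h0 : tripleLaw PX η κ {t | decoderDensity PX η p t.2.1 t.2.2 ≤ 0} = 0 := by
      rw [← lintegral_indicator_one hS, lintegral_tripleLaw PX η (measurable_one.indicator hS),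
        lintegral_compProd_eq_posterior]
      · refine (lintegral_congr fun x' => ?_).trans lintegral_zero
        have hS' : MeasurableSet {y | decoderDensity PX η p x' y ≤ 0} :=
          measurableSet_le (hg.comp (f := fun y => (x', y)) (by fun_prop)) measurable_const
        refine (lintegral_decoderDensity_mul PX η hp hp0 hκ hpq x'
          (measurable_one.indicator hS')).trans ?_
        refine (lintegral_congr fun y => ?_).trans lintegral_zero
        by_cases h : decoderDensity PX η p x' y ≤ 0
        · simp [ENNReal.ofReal_of_nonpos h]
        · simp [Set.indicator, h]
      · exact Measurable.lintegral_kernel_prod_right' (κ := κ.comap Prod.fst measurable_fst)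
          (f := fun s : (𝒳 × 𝒳') × 𝒴 => ({t : 𝒳 × 𝒳' × 𝒴 |
            decoderDensity PX η p t.2.1 t.2.2 ≤ 0}.indicator 1 (s.1.1, s.1.2, s.2) : ℝ≥0∞))
          ((measurable_one.indicator hS).comp (f := fun s : (𝒳 × 𝒳') × 𝒴 =>
            (s.1.1, s.1.2, s.2)) (by fun_prop))
    filter_upwards [measure_eq_zero_iff_ae_notMem.mp h0] with t ht
    exact not_le.mp ht

end Decoder

/-! ### Prefix-free codes -/

section Codes

/-- The unary code `1ⁿ0`. -/
def unaryCode (n : ℕ) : List Bool := List.replicate n true ++ [false]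

lemma length_unaryCode (n : ℕ) : (unaryCode n).length = n + 1 := by simp [unaryCode]

lemma isPrefixFree_unaryCode : IsPrefixFree unaryCode := by
  intro a
  induction a with
  | zero =>
    intro b h
    cases b with
    | zero => rfl
    | succ b => simp [unaryCode, List.replicate_succ] at h
  | succ a ih =>
    intro b h
    cases b with
    | zero => simp [unaryCode, List.replicate_succ] at h
    | succ b =>
      rw [unaryCode, unaryCode, List.replicate_succ, List.replicate_succ, List.cons_append,
        List.cons_append, List.cons_prefix_cons] at h
      rw [ih b h.2]

/-- An injective code of fixed length is prefix-free: a prefix of full length is the whole word. -/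
lemma exists_isPrefixFree_length_eq_clog (V : ℕ) :
    ∃ c : Fin V → List Bool, IsPrefixFree c ∧ ∀ v, (c v).length = Nat.clog 2 V := by
  have hcard : Fintype.card (Fin V) ≤ Fintype.card (List.Vector Bool (Nat.clog 2 V)) := by
    rw [card_vector, Fintype.card_bool, Fintype.card_fin]
    exact Nat.le_pow_clog one_lt_two V
  obtain ⟨e⟩ := Function.Embedding.nonempty_of_card_le hcard
  refine ⟨fun v => (e v).toList, fun a b h => ?_, fun v => (e v).toList_length⟩
  exact e.injective (Subtype.ext (h.eq_of_length (by simp)))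

end Codes

/-! ### The expected batch index -/

section System

variable {𝒳 𝒳' 𝒴 : Type*} [MeasurableSpace 𝒳] [MeasurableSpace 𝒳'] [MeasurableSpace 𝒴]
  (PX : Measure 𝒳) [IsProbabilityMeasure PX] (η : Kernel 𝒳 𝒳') [IsMarkovKernel η]
  (Q : Measure 𝒴) [IsProbabilityMeasure Q]

instance (N V : ℕ) [NeZero V] : IsProbabilityMeasure (randomnessLaw Q N V) := by
  unfold randomnessLaw; infer_instance

instance (N V : ℕ) [NeZero V] : IsProbabilityMeasure (systemLaw PX η Q N V) := by
  unfold systemLaw; infer_instance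

lemma randomnessLaw_forall_lt_notMem {N V : ℕ} [NeZero V] {A : Set (Batch 𝒴 N V)}
    (hA : MeasurableSet A) (k : ℕ) :
    randomnessLaw Q N V {W | ∀ i < k, W i ∉ A} = batchLaw Q N V Aᶜ ^ k := by
  have h : {W : Randomness 𝒴 N V | ∀ i < k, W i ∉ A}
      = Set.pi (Finset.range k) fun _ => Aᶜ := by
    ext W
    simp [Set.mem_pi]
  rw [h, randomnessLaw, Measure.infinitePi_pi _ fun _ _ => hA.compl, Finset.prod_const,
    Finset.card_range]

/-- Tail summation: the first k batches all miss the accept event with probability at most 2⁻ᵏ, and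
these bounds sum to 2. -/
lemma lintegral_batchIndex_add_one_le {n V : ℕ} [NeZero V] {p : 𝒳 → 𝒴 → ℝ}
    (hp : Measurable (Function.uncurry p)) (hp0 : ∀ x y, 0 ≤ p x y) {q : 𝒴 → ℝ}
    (hq : Measurable q) (hq0 : ∀ y, 0 ≤ q y) {w : 𝒳 → ℝ} (hw : Measurable w)
    (hwb : ∀ x, BoundingCondition (p x) q (w x)) (hwn : ∀ x, w x ≤ n + 1)
    (h1 : ∀ x, ∫⁻ y, ENNReal.ofReal (p x y / q y) ∂Q = 1) :
    ∫⁻ t, ((batchIndex (p t.1.1) q (w t.1.1) t.2 + 1 : ℕ) : ℝ≥0∞)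
      ∂(systemLaw PX η Q (n + 1) V) ≤ 2 := by
  have hl : Measurable (Function.uncurry fun x y => p x y / q y) :=
    hp.div (hq.comp measurable_snd)
  have hA := measurableSet_acceptEvent (n := n) (V := V) hl hw
  let R (k : ℕ) : Set ((𝒳 × 𝒳') × Randomness 𝒴 (n + 1) V) :=
    {t | ∀ i < k, t.2 i ∉ acceptEvent (fun y => p t.1.1 y / q y) (w t.1.1) n V}
  have hR (k : ℕ) : MeasurableSet (R k) := by
    have : R k = ⋂ i, ⋂ _ : i < k,
        {t : (𝒳 × 𝒳') × Randomness 𝒴 (n + 1) V |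
          t.2 i ∈ acceptEvent (fun y => p t.1.1 y / q y) (w t.1.1) n V}ᶜ := by
      ext t; simp [R]
    rw [this]
    refine MeasurableSet.iInter fun i => MeasurableSet.iInter fun _ => MeasurableSet.compl ?_
    exact measurableSet_preimage (f := fun t : (𝒳 × 𝒳') × Randomness 𝒴 (n + 1) V =>
      (t.1.1, t.2 i)) (by fun_prop) hA
  have hmeas (k : ℕ) : systemLaw PX η Q (n + 1) V (R k) ≤ 2⁻¹ ^ k := by
    rw [systemLaw, Measure.prod_apply (hR k)]
    refine (lintegral_mono (g := fun _ => 2⁻¹ ^ k) fun s => ?_).trans (by simp)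
    have hlx : Measurable fun y => p s.1 y / q y := hl.comp (f := fun y => (s.1, y)) (by fun_prop)
    have hAx : MeasurableSet (acceptEvent (fun y => p s.1 y / q y) (w s.1) n V) :=
      measurableSet_preimage (f := fun B => (s.1, B)) (by fun_prop) hA
    refine (randomnessLaw_forall_lt_notMem Q hAx k).trans_le ?_
    rw [prob_compl_eq_one_sub hAx]
    refine pow_le_pow_left' ?_ k
    rw [tsub_le_iff_right]
    have h2 := le_batchLaw_acceptEvent Q (n := n) (V := V) hlx
      (fun y => div_nonneg (hp0 _ _) (hq0 _)) (h1 s.1) (hwb s.1).1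
      (ratio_le hq0 (zero_le_one.trans (hwb s.1).1) (hwb s.1).2) (hwn s.1)
    calc (1 : ℝ≥0∞) = 2⁻¹ + 2⁻¹ := ENNReal.inv_two_add_inv_two.symm
      _ ≤ _ := by gcongr
  -- Every k from 0 to the index satisfies t ∈ R k, which accounts for the +1. If no batch is
  -- accepted, the default index 0 only needs the vacuous R 0. An upper bound requires measurability
  -- of the sets R k only.
  have hpt (t : (𝒳 × 𝒳') × Randomness 𝒴 (n + 1) V) :
      ((batchIndex (p t.1.1) q (w t.1.1) t.2 + 1 : ℕ) : ℝ≥0∞) ≤ ∑' k, (R k).indicator 1 t := by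
    have hmem : ∀ k ∈ Finset.range (batchIndex (p t.1.1) q (w t.1.1) t.2 + 1),
        ((R k).indicator 1 t : ℝ≥0∞) = 1 := fun k hk => by
      refine Set.indicator_of_mem (fun i hi hmem => ?_) _
      refine Nat.notMem_of_lt_sInf (s := {i | Accepts (p t.1.1) q (w t.1.1) (t.2 i)})
        (hi.trans_le (Nat.lt_succ_iff.mp (Finset.mem_range.mp hk))) ?_
      exact accepts_of_mem_acceptEvent (hp0 _) hq0 hmem
    refine le_trans (le_of_eq ?_) (ENNReal.sum_le_tsum
      (Finset.range (batchIndex (p t.1.1) q (w t.1.1) t.2 + 1)))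
    rw [Finset.sum_congr rfl hmem]
    simp
  refine (lintegral_mono hpt).trans ?_
  rw [lintegral_tsum fun k => (measurable_one.indicator (hR k)).aemeasurable]
  simp_rw [lintegral_indicator_one (hR _)]
  refine (ENNReal.tsum_le_tsum hmeas).trans_eq ?_
  rw [ENNReal.tsum_geometric, ENNReal.one_sub_inv_two, inv_inv]

end System

/-! ### The decoding error -/

section Error

variable {𝒳 𝒳' 𝒴 : Type*} [MeasurableSpace 𝒳] [StandardBorelSpace 𝒳] [Nonempty 𝒳]
  [MeasurableSpace 𝒳'] [MeasurableSpace 𝒴]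
  (PX : Measure 𝒳) [IsProbabilityMeasure PX] (η : Kernel 𝒳 𝒳') [IsMarkovKernel η]
  {κ : Kernel 𝒳 𝒴} [IsMarkovKernel κ] (Q : Measure 𝒴) [IsProbabilityMeasure Q]

/-- The error event lies in the complement of the measurable event `G` that the first batch is a
match. The bound for one batch is integrated over the law of (X, X'), and one minus the result is
the stated expectation. -/
lemma measureReal_errorEvent_le {ν : Measure 𝒴} [SigmaFinite ν] {p : 𝒳 → 𝒴 → ℝ}
    (hp : Measurable (Function.uncurry p)) (hp0 : ∀ x y, 0 ≤ p x y)
    (hκ : ∀ x, κ x = ν.withDensity fun y => ENNReal.ofReal (p x y))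
    {q : 𝒴 → ℝ} (hq : Measurable q) (hq0 : ∀ y, 0 ≤ q y)
    (hQ : Q = ν.withDensity fun y => ENNReal.ofReal (q y)) {ω : ℝ}
    (hω : ExtendedBoundingCondition p q ω) {w : 𝒳 → ℝ} (hw : Measurable w)
    (hwb : ∀ x, BoundingCondition (p x) q (w x)) {ε : ℝ} (hε : 0 < ε) {n V : ℕ} [NeZero V]
    (hmu : ∀ᵐ x ∂PX, mu1 (w x) (n + 1) ≤ ENNReal.ofReal ε ∧
      mu2 (w x) ω (n + 1) (d2 Q q (p x)) ≤ ENNReal.ofReal ε)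
    (h1 : ∀ x, ∫⁻ y, ENNReal.ofReal (p x y / q y) ∂Q = 1) :
    (systemLaw PX η Q (n + 1) V).real (errorEvent PX η p q w (n + 1) V)
      ≤ ∫ t, errorBound PX η p ε V t ∂(tripleLaw PX η κ) := by
  have : IsProbabilityMeasure (tripleLaw PX η κ) := by unfold tripleLaw; infer_instance
  have hg := measurable_decoderDensity PX η hp hp0 hω.2
  have hg0 := decoderDensity_nonneg PX η (p := p) hp0
  have hgq := decoderDensity_le PX η hp0 hω.2
  have hV : (0 : ℝ) < V := by exact_mod_cast Nat.pos_of_ne_zero (NeZero.ne V)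
  have hl : Measurable (Function.uncurry fun x y => p x y / q y) :=
    hp.div (hq.comp measurable_snd)
  have hgr : Measurable (Function.uncurry fun x' y => decoderDensity PX η p x' y / q y) :=
    hg.div (hq.comp measurable_snd)
  let l (t : 𝒳 × 𝒳' × 𝒴) : ℝ := p t.1 t.2.2 / q t.2.2
  let g (t : 𝒳 × 𝒳' × 𝒴) : ℝ := decoderDensity PX η p t.2.1 t.2.2 / q t.2.2
  have hlm : Measurable l := hl.comp (f := fun t : 𝒳 × 𝒳' × 𝒴 => (t.1, t.2.2)) (by fun_prop)
  have hgm : Measurable g := hgr.comp (f := fun t : 𝒳 × 𝒳' × 𝒴 => t.2) (by fun_prop)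
  have hl0 (t) : 0 ≤ l t := div_nonneg (hp0 _ _) (hq0 _)
  have hgg0 (t) : 0 ≤ g t := div_nonneg (hg0 _ _) (hq0 _)
  -- the conditional probability bound for a correct decision, given `(x, x', y)`
  let H (t : 𝒳 × 𝒳' × 𝒴) : ℝ := {t | 0 < l t ∧ 0 < g t}.indicator
    (fun t => (1 + ε + (1 + ε) * (V : ℝ)⁻¹ * (l t / g t))⁻¹) t
  have hS : MeasurableSet {t | 0 < l t ∧ 0 < g t} :=
    (measurableSet_lt measurable_const hlm).inter (measurableSet_lt measurable_const hgm)
  have hHm : Measurable H := Measurable.indicator (by fun_prop) hS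
  have hH0 (t) : 0 ≤ H t := Set.indicator_nonneg (fun t _ => by
    have := hl0 t; have := hgg0 t; positivity) t
  have hH1 (t) : H t ≤ 1 := by
    refine Set.indicator_le' (g := fun _ => (1 : ℝ)) (fun t _ => ?_) (fun t _ => zero_le_one) t
    have h3 : 0 ≤ (1 + ε) * (V : ℝ)⁻¹ * (l t / g t) := by
      have := hl0 t; have := hgg0 t; positivity
    exact inv_le_one_of_one_le₀ (by linarith)
  have hHi : Integrable H (tripleLaw PX η κ) := by
    refine Integrable.of_bound hHm.aestronglyMeasurable 1 (ae_of_all _ fun t => ?_)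
    rw [Real.norm_of_nonneg (hH0 t)]
    exact hH1 t
  have hbound : ∫ t, errorBound PX η p ε V t ∂(tripleLaw PX η κ)
      = 1 - ∫ t, H t ∂(tripleLaw PX η κ) := by
    have h2 : ∫ t, errorBound PX η p ε V t ∂(tripleLaw PX η κ)
        = ∫ t, (1 - H t) ∂(tripleLaw PX η κ) := by
      refine integral_congr_ae ?_
      filter_upwards [ae_tripleLaw_pos PX η hp hp0 hκ hω.2] with t ht
      have hqt : 0 < q t.2.2 := by
        by_contra hc
        have := hω.2 t.1 t.2.2
        rw [le_antisymm (not_lt.mp hc) (hq0 _), mul_zero] at this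
        linarith [ht.1]
      have hmem : t ∈ {t | 0 < l t ∧ 0 < g t} := ⟨div_pos ht.1 hqt, div_pos ht.2 hqt⟩
      simp only [errorBound, H, Set.indicator_of_mem hmem]
      have hlg : l t / g t = p t.1 t.2.2 / decoderDensity PX η p t.2.1 t.2.2 :=
        div_div_div_cancel_right₀ hqt.ne' _ _
      -- The marginal term drops out of the difference of information densities, so its positivity
      -- is not needed.
      rw [hlg, infoDensity, infoDensity, sub_sub_sub_cancel_right, Real.rpow_sub two_pos,
        Real.rpow_logb two_pos (by norm_num) ht.1, Real.rpow_logb two_pos (by norm_num) ht.2]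
    rw [h2, integral_sub (integrable_const _) hHi]
    simp
  let G : Set ((𝒳 × 𝒳') × Randomness 𝒴 (n + 1) V) :=
    {t | t.2 0 ∈ matchEvent (fun y => p t.1.1 y / q y)
      (fun y => decoderDensity PX η p t.1.2 y / q y) (w t.1.1) n V}
  have hM := measurableSet_matchEvent (P := 𝒳 × 𝒳') (n := n) (V := V)
    (l := fun s y => p s.1 y / q y) (g := fun s y => decoderDensity PX η p s.2 y / q y)
    (c := fun s => w s.1)
    (hl.comp (f := fun s : (𝒳 × 𝒳') × 𝒴 => (s.1.1, s.2)) (by fun_prop))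
    (hgr.comp (f := fun s : (𝒳 × 𝒳') × 𝒴 => (s.1.2, s.2)) (by fun_prop))
    (hw.comp measurable_fst)
  have hG : MeasurableSet G := measurableSet_preimage
    (f := fun t : (𝒳 × 𝒳') × Randomness 𝒴 (n + 1) V => (t.1, t.2 0)) (by fun_prop) hM
  have hsub : errorEvent PX η p q w (n + 1) V ⊆ Gᶜ := fun t ht hGt => ht (by
    rw [decode_eq_of_mem_matchEvent (hp0 _) (hg0 _) hq0 hGt])
  have hmain : ENNReal.ofReal (∫ t, H t ∂(tripleLaw PX η κ)) ≤ systemLaw PX η Q (n + 1) V G := by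
    rw [ofReal_integral_eq_lintegral_ofReal hHi (ae_of_all _ hH0),
      lintegral_tripleLaw PX η (F := fun t => ENNReal.ofReal (H t)) (by fun_prop),
      systemLaw, Measure.prod_apply hG]
    have hmu' : ∀ᵐ s ∂(PX ⊗ₘ η), mu1 (w s.1) (n + 1) ≤ ENNReal.ofReal ε ∧
        mu2 (w s.1) ω (n + 1) (d2 Q q (p s.1)) ≤ ENNReal.ofReal ε := by
      have hfst : MeasurePreserving Prod.fst (PX ⊗ₘ η) PX :=
        ⟨measurable_fst, by rw [← Measure.fst, Measure.fst_compProd]⟩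
      exact hfst.quasiMeasurePreserving.ae hmu
    refine lintegral_mono_ae (hmu'.mono fun s hs => ?_)
    have hps : Measurable (p s.1) := hp.comp (f := fun y => (s.1, y)) (by fun_prop)
    have hgs : Measurable (decoderDensity PX η p s.2) :=
      hg.comp (f := fun y => (s.2, y)) (by fun_prop)
    have hMs : MeasurableSet (matchEvent (fun y => p s.1 y / q y)
        (fun y => decoderDensity PX η p s.2 y / q y) (w s.1) n V) :=
      measurableSet_preimage (f := fun B => (s, B)) (by fun_prop) hM
    have hHs : Measurable fun y => H (s.1, s.2, y) := by fun_prop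
    have hg1 : ∫⁻ y, ENNReal.ofReal (decoderDensity PX η p s.2 y / q y) ∂Q ≤ 1 := by
      have h3 := lintegral_ratio_mul hgs (hg0 s.2) hq hq0 hQ (hgq s.2) (h := fun _ => 1)
        measurable_const
      have h4 := lintegral_decoderDensity_mul PX η hp hp0 hκ hω.2 s.2 (h := fun _ => 1)
        measurable_const
      rw [← h4] at h3
      simp only [mul_one, lintegral_const, measure_univ] at h3
      exact h3.le
    have key := le_batchLaw_matchEvent Q (n := n) (V := V) (hps.div hq) (hgs.div hq)
      (fun y => div_nonneg (hp0 _ _) (hq0 _)) (fun y => div_nonneg (hg0 _ _) (hq0 _))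
      (h1 s.1).le hg1 (hwb s.1).1 (ratio_le hq0 (zero_le_one.trans (hwb s.1).1) (hwb s.1).2)
      (ratio_le hq0 (zero_le_one.trans hω.1) (hgq s.2)) hε
      (lintegral_inv_ratio_le_d2 hps hq hq0 hQ) hs.1 hs.2
    have heval : randomnessLaw Q (n + 1) V (Prod.mk s ⁻¹' G)
        = batchLaw Q (n + 1) V (matchEvent (fun y => p s.1 y / q y)
          (fun y => decoderDensity PX η p s.2 y / q y) (w s.1) n V) :=
      (measurePreserving_eval_infinitePi (fun _ : ℕ => batchLaw Q (n + 1) V) 0).measure_preimage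
        hMs.nullMeasurableSet
    rw [heval]
    refine le_trans (le_of_eq ?_) key
    -- The reference measure passes from `κ` through `ν` to `Q`, which produces the factor `l` of
    -- the batch bound.
    rw [lintegral_eq_lintegral_density_mul hp hκ s.1 hHs.ennreal_ofReal,
      ← lintegral_ratio_mul hps (hp0 s.1) hq hq0 hQ (hwb s.1).2 hHs.ennreal_ofReal,
      ← lintegral_indicator]
    · refine lintegral_congr fun y => ?_
      rw [← ENNReal.ofReal_mul (div_nonneg (hp0 _ _) (hq0 _))]
      by_cases hy : 0 < p s.1 y / q y ∧ 0 < decoderDensity PX η p s.2 y / q y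
      · have hmem : (s.1, s.2, y) ∈ {t | 0 < l t ∧ 0 < g t} := hy
        rw [Set.indicator_of_mem (by exact hy)]
        rw [show H (s.1, s.2, y) = _ from Set.indicator_of_mem hmem _, ← div_eq_mul_inv]
        rfl
      · have hmem : (s.1, s.2, y) ∉ {t | 0 < l t ∧ 0 < g t} := hy
        rw [Set.indicator_of_notMem (by exact hy)]
        simp only [H, Set.indicator_of_notMem hmem, mul_zero, ENNReal.ofReal_zero]
    · exact (measurableSet_lt measurable_const (hps.div hq)).inter
        (measurableSet_lt measurable_const (hgs.div hq))
  rw [hbound]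
  calc _ ≤ (systemLaw PX η Q (n + 1) V).real Gᶜ := measureReal_mono hsub
    _ = 1 - (systemLaw PX η Q (n + 1) V).real G := probReal_compl_eq_one_sub hG
    _ ≤ _ := by
      refine sub_le_sub_left ?_ _
      exact (ENNReal.ofReal_le_iff_le_toReal (measure_ne_top _ _)).mp hmain

end Error

end

end ERS

open ERS in
theorem proposition4
    {𝒳 𝒳' 𝒴 : Type*}
    [MeasurableSpace 𝒳] [StandardBorelSpace 𝒳] [Nonempty 𝒳]
    [MeasurableSpace 𝒳'] [MeasurableSpace 𝒴]
    -- the source, the side information channel `P_{X'|X}` and the target channel `P_{Y'|X}`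
    (PX : Measure 𝒳) [IsProbabilityMeasure PX]
    (η : Kernel 𝒳 𝒳') [IsMarkovKernel η]
    (κ : Kernel 𝒳 𝒴) [IsMarkovKernel κ]
    -- the proposal distribution
    (Q : Measure 𝒴) [IsProbabilityMeasure Q]
    -- densities of the target channel and of the proposal
    (ν : Measure 𝒴) [SigmaFinite ν]
    (p : 𝒳 → 𝒴 → ℝ) (hp : Measurable (Function.uncurry p)) (hp0 : ∀ x y, 0 ≤ p x y)
    (hκ : ∀ x, κ x = ν.withDensity fun y => ENNReal.ofReal (p x y))
    (q : 𝒴 → ℝ) (hq : Measurable q) (hq0 : ∀ y, 0 ≤ q y)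
    (hQ : Q = ν.withDensity fun y => ENNReal.ofReal (q y))
    -- the extended bounding condition, and the ratio bounds used by the encoder
    (ω : ℝ) (hω : ExtendedBoundingCondition p q ω)
    (w : 𝒳 → ℝ) (hw : Measurable w) (hwb : ∀ x, BoundingCondition (p x) q (w x))
    (hwω : ∀ x, w x ≤ ω)
    -- the accuracy, the number of hash values and the batch size
    (ε : ℝ) (hε : 0 < ε) (V : ℕ) [NeZero V]
    (N₀ : ℕ) (hN₀ : IsThreshold PX Q p q w ω ε N₀)
    (N : ℕ) [NeZero N] (hN : max (N₀ : ℝ) ω ≤ N) :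
    -- the decoding error
    (systemLaw PX η Q N V).real (errorEvent PX η p q w N V)
        ≤ ∫ t, errorBound PX η p ε V t ∂(tripleLaw PX η κ) ∧
    -- the coding cost
    ∃ (c₁ : ℕ → List Bool) (c₂ : Fin V → List Bool) (r : ℝ≥0∞),
      IsPrefixFree c₁ ∧ IsPrefixFree c₂ ∧ (∀ v, (c₂ v).length = Nat.clog 2 V) ∧
      r = codingCost (systemLaw PX η Q N V)
        (fun t => c₁ (message (p t.1.1) q (w t.1.1) t.2).1) ∧
      r ≤ 4 ∧
      codingCost (systemLaw PX η Q N V)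
        (fun t => c₁ (message (p t.1.1) q (w t.1.1) t.2).1 ++
          c₂ (message (p t.1.1) q (w t.1.1) t.2).2) = Nat.clog 2 V + r ∧
      Nat.clog 2 V + r ≤ ENNReal.ofReal (Real.logb 2 V) + 4 := by
  -- A batch is one candidate together with `n` competitors.
  obtain ⟨n, rfl⟩ := Nat.exists_eq_succ_of_ne_zero (NeZero.ne N)
  have hNn : (N₀ : ℝ) ≤ (n + 1 : ℕ) := (le_max_left _ _).trans hN
  have hωn : ω ≤ n + 1 := by exact_mod_cast (le_max_right _ _).trans hN
  have h1 (x : 𝒳) : ∫⁻ y, ENNReal.ofReal (p x y / q y) ∂Q = 1 := by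
    have hpx : Measurable (p x) := hp.comp (f := fun y => (x, y)) (by fun_prop)
    have h2 := lintegral_ratio_mul hpx (hp0 x) hq hq0 hQ (hwb x).2 (h := fun _ => 1)
      measurable_const
    rw [← lintegral_eq_lintegral_density_mul hp hκ x measurable_const] at h2
    simpa using h2
  refine ⟨measureReal_errorEvent_le PX η Q hp hp0 hκ hq hq0 hQ hω hw hwb hε
    (hN₀ _ (by exact_mod_cast hNn)) h1, ?_⟩
  obtain ⟨c₂, hc₂, hlen⟩ := exists_isPrefixFree_length_eq_clog V
  have hr : codingCost (systemLaw PX η Q (n + 1) V)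
      (fun t => unaryCode (message (p t.1.1) q (w t.1.1) t.2).1) ≤ 2 := by
    unfold codingCost
    simp_rw [length_unaryCode]
    exact lintegral_batchIndex_add_one_le PX η Q hp hp0 hq hq0 hw hwb
      (fun x => (hwω x).trans hωn) h1
  refine ⟨unaryCode, c₂, _, isPrefixFree_unaryCode, hc₂, hlen, rfl,
    hr.trans (by norm_num), ?_, ?_⟩
  · unfold codingCost
    simp_rw [List.length_append, hlen, Nat.cast_add]
    rw [lintegral_add_right _ measurable_const, lintegral_const, measure_univ, mul_one, add_comm]
  -- One bit for rounding up plus two for the batch index stay below the allowed four.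
  · have hclog : (Nat.clog 2 V : ℝ≥0∞) ≤ ENNReal.ofReal (Real.logb 2 V) + 1 := by
      have hV : (1 : ℝ) ≤ V := by exact_mod_cast Nat.pos_of_ne_zero (NeZero.ne V)
      have hlog : 0 ≤ Real.logb 2 V := Real.logb_nonneg one_lt_two hV
      have h3 := (Nat.ceil_lt_add_one hlog).le
      rw [show (2 : ℝ) = ((2 : ℕ) : ℝ) by norm_num, Real.natCeil_logb_natCast] at h3
      rw [← ENNReal.ofReal_natCast, ← ENNReal.ofReal_one, ← ENNReal.ofReal_add hlog zero_le_one]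
      exact ENNReal.ofReal_le_ofReal (by exact_mod_cast h3)
    refine (add_le_add hclog hr).trans ?_
    rw [add_assoc]
    gcongr
    norm_num
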